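/- Let $U\subset\mathbb C$ be a simply connected domain and let $\Phi$ be a piecewise analytic function on $U$: there are finitely many pairwise disjoint open sets $M_1,\dots,M_r\subset U$ that cover $U$ up to a set of Lebesgue measure $0$, and pairwise distinct analytic functions $A_1,\dots,A_r$ on $U$, such that $\Phi=\sum_{i=1}^r A_i\chi_{M_i}$ almost everywhere in $U$, where $\chi_{M_i}$ is the characteristic function of $M_i$. Assume that $\partial\Phi/\partial\bar z\ge 0$ in $U$ in the sense of distributions. Let $p\in U$ be a point such that $A_i(p)\ne A_k(p)$ for all $i\ne k$ in $\{1,\dots,r\}$. Put $$I(p)=\{j\in\{1,\dots,r\}\mid p\in\overline{M_j}\},$$ let $K\subset\mathbb C$ be the convex hull of the points $A_i(p)$, $i\in I(p)$, let $\partial K$ be the topological boundary of $K$ in $\mathbb C$, and let $$S(p)=\{i\in I(p)\mid A_i(p)\text{ is an extreme point of }K\}.$$ If $A_k(p)\notin\partial K$ for every $k\in I(p)\setminus S(p)$, then there is a neighborhood $N$ of $p$ in $U$ such that $$\Phi=2\,\frac{\partial\varphi}{\partial z}\quad\text{almost everywhere in }N,$$ where $\varphi(z)=\max_{i\in I(p)}H_i(z)$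 with $H_i(z)=\operatorname{Re}\int_p^z A_i(w)\,dw$, and the derivative is taken in the sense of distributions. -/

import Mathlib

open MeasureTheory Set TopologicalSpace
open scoped Distributions LineDeriv

noncomputable section

namespace PiecewiseAnalytic

/-- The complex-valued distribution `ψ ↦ ∫ ψ f` on the open set `U` defined by a function `f`
that is locally integrable on `U` (for other `f` this is the zero distribution). -/
def ofFun (U : Opens ℂ) (f : ℂ → ℂ) : 𝓓'(U, ℂ) :=
  (ContinuousLinearMap.toUniformConvergenceCLM (RingHom.id ℝ) ℂ _)
    (TestFunction.integralAgainstBilinCLM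
      (ContinuousLinearMap.lsmul ℝ ℝ : ℝ →L[ℝ] ℂ →L[ℝ] ℂ) volume f)

/-- The distributional Wirtinger derivative `∂T/∂z = (∂T/∂x - i ∂T/∂y) / 2`. -/
def dz {U : Opens ℂ} (T : 𝓓'(U, ℂ)) : 𝓓'(U, ℂ) :=
  (1 / 2 : ℂ) • (∂_{(1 : ℂ)} T - Complex.I • ∂_{Complex.I} T)

/-- The distributional Wirtinger derivative `∂T/∂z̄ = (∂T/∂x + i ∂T/∂y) / 2`. -/
def dzbar {U : Opens ℂ} (T : 𝓓'(U, ℂ)) : 𝓓'(U, ℂ) :=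
  (1 / 2 : ℂ) • (∂_{(1 : ℂ)} T + Complex.I • ∂_{Complex.I} T)

/-- A complex-valued distribution is positive if it takes real nonnegative values at all
nonnegative test functions. -/
def IsPositive {U : Opens ℂ} (T : 𝓓'(U, ℂ)) : Prop :=
  ∀ ψ : 𝓓(U, ℝ), (∀ x, 0 ≤ ψ x) → 0 ≤ (T ψ).re ∧ (T ψ).im = 0

/-- The set `Σ(U)` of distributions on `U` whose derivative with respect to `z̄` is positive. -/
def SigmaClass (U : Opens ℂ) : Set 𝓓'(U, ℂ) := {T | IsPositive (dzbar T)}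

/-- `Φ` is the piecewise analytic function on `U` given by the pairwise disjoint open sets
`M i ⊆ U`, covering `U` up to a Lebesgue null set, and the pairwise distinct analytic functions
`A i` on `U`: one has `Φ = ∑ i, A i * χ_{M i}` almost everywhere in `U`. -/
structure IsPiecewiseAnalytic (U : Opens ℂ) {r : ℕ} (M : Fin r → Set ℂ) (A : Fin r → ℂ → ℂ)
    (Φ : ℂ → ℂ) : Prop where
  isOpen : ∀ i, IsOpen (M i)
  subset : ∀ i, M i ⊆ U
  disjoint : ∀ i j, i ≠ j → Disjoint (M i) (M j)
  null : volume ((U : Set ℂ) \ ⋃ i, M i) = 0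
  analytic : ∀ i, AnalyticOnNhd ℂ (A i) U
  distinct : ∀ i j, i ≠ j → ¬ EqOn (A i) (A j) U
  ae_eq : ∀ᵐ z ∂(volume.restrict (U : Set ℂ)), Φ z = ∑ i, (M i).indicator (A i) z

/-- `γ` is a continuously differentiable path that stays in `U`. -/
def IsC1PathIn (U : Set ℂ) {p z : ℂ} (γ : Path p z) : Prop :=
  ContDiffOn ℝ 1 γ.extend (Icc 0 1) ∧ ∀ t, γ t ∈ U

/-- The holomorphic 1-form `A(w) dw`. -/
def oneForm (A : ℂ → ℂ) : ℂ → ℂ →L[ℂ] ℂ := fun w => ContinuousLinearMap.toSpanSingleton ℂ (A w)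

open scoped Classical in
/-- `∫_p^z A(w) dw`, the integral being taken along a continuously differentiable path in `U`
from `p` to `z`: along the straight segment if it lies in `U`, otherwise along any such path
(and `0` if there is none). If `U` is a simply connected domain containing `p` and `z`, and `A`
is analytic in `U`, then such a path exists, and by Cauchy's theorem the integral has the same
value for all of them. -/
def pathIntegral (U : Set ℂ) (A : ℂ → ℂ) (p z : ℂ) : ℂ :=
  if segment ℝ p z ⊆ U then curveIntegral (oneForm A) (Path.segment p z)
  else if h : ∃ γ : Path p z, IsC1PathIn U γ then curveIntegral (oneForm A) h.choose
  else 0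

/-- The harmonic function `H(z) = Re ∫_p^z A(w) dw`. -/
def potential (U : Set ℂ) (A : ℂ → ℂ) (p z : ℂ) : ℝ := (pathIntegral U A p z).re

/-- The set `I(p)` of active indices at `p`: those `j` with `p` in the closure of `M j`. -/
def activeSet {r : ℕ} (M : Fin r → Set ℂ) (p : ℂ) : Set (Fin r) := {j | p ∈ closure (M j)}

/-- The convex hull `K` of the points `A i (p)`, `i ∈ I(p)`. -/
def hull {r : ℕ} (M : Fin r → Set ℂ) (A : Fin r → ℂ → ℂ) (p : ℂ) : Set ℂ :=
  convexHull ℝ ((fun i => A i p) '' activeSet M p)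

/-- The set `S(p)` of those `i ∈ I(p)` for which `A i (p)` is an extreme point of `K`. -/
def extremeSet {r : ℕ} (M : Fin r → Set ℂ) (A : Fin r → ℂ → ℂ) (p : ℂ) : Set (Fin r) :=
  {i ∈ activeSet M p | A i p ∈ (hull M A p).extremePoints ℝ}

/-- `φ(z) = max_{i ∈ I(p)} H i (z)` (a supremum over a finite index set, which is nonempty
whenever `p ∈ U` and the `M i` cover `U` up to a null set). -/
def maxPotential (U : Set ℂ) {r : ℕ} (M : Fin r → Set ℂ) (A : Fin r → ℂ → ℂ) (p z : ℂ) : ℝ :=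
  ⨆ i : activeSet M p, potential U (A i) p z

/-- `Φ = 2 ∂φ/∂z` almost everywhere in the open set `N`: the distributional derivative `∂φ/∂z`
on `N` is a locally integrable function `g`, and `Φ = 2 g` almost everywhere in `N`. -/
def EqTwoDz (N : Opens ℂ) (Φ : ℂ → ℂ) (φ : ℂ → ℝ) : Prop :=
  LocallyIntegrableOn φ (N : Set ℂ) ∧
  ∃ g : ℂ → ℂ, LocallyIntegrableOn g (N : Set ℂ) ∧
    ofFun N g = dz (ofFun N (fun z => (φ z : ℂ))) ∧
    ∀ᵐ z ∂(volume.restrict (N : Set ℂ)), Φ z = 2 * g z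

end PiecewiseAnalytic

end

/-!
The function `Φ` is bounded and measurable near `p` and `∂Φ/∂z̄` is real there, so the form
`Re (Φ dz)` is closed in the weak sense and has a Lipschitz potential `u` with `u p = 0`
(`exists_weakPotential`). This `u` satisfies `Φ = 2 ∂u/∂z`, and it is subharmonic because
`∂Φ/∂z̄ ≥ 0`. What has to be shown is that `u = max H_i` near `p`, the maximum being taken over the
active indices (`eventually_eq_iSup`). No regularity of the sets `M i` is available; in particular
`u - H_i` might take infinitely many values on `M i`, one for each component.

If `A i p` is an extreme point of `K`, it is strictly exposed, so that for some `v₀` and all `v`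
close to `v₀` one has `Re ((A j - A i) v) > 0` near `p` for all other active `j`. Hence `u - H_i`
increases in all directions of an open cone. At a point `q` of `M i` the function `u - H_i` is
locally constant, and it is at most its value at `q` on the cone below `q`; by the strong maximum
principle it is constant on that cone. The cones below any two points near `p` meet, and points
above a cone have larger values, so `u - H_i` attains its minimum near `p` at every point of
`M i`. As `p` is adherent to `M i` the minimum is `0` (`eventually_le_of_cone`). Thus `u ≥ H_i`
near `p`, with equality on `M i`.

If `A k p` is an interior point of `K`, then near `p` its potential is strictly dominated in radial
growth by any potential that is maximal at the given point (`eventually_radial_pos`). For this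
reason only extreme pieces contribute to the maximum, which gives `u ≥ max H_i`; and on the open set
`u > max H_i`, where only interior pieces can occur, `u - max H_i` would strictly increase towards
`p`, where it vanishes. So this set is empty near `p`, and `u = max H_i`.

All arguments are carried out in discs around `p`, where `pathIntegral` integrates along segments.
The strong maximum principle is needed only when the maximum is attained on an open set, and then
it follows by testing subharmonicity against a radial barrier function, without any mean value
property (`WeakSubharmonic.eq_zero_of_ball`).
-/

namespace PiecewiseAnalytic

open Filter Topology Metric
open scoped ContDiff Convolution NNReal

/-! ### Test functions, weak potentials and mollification -/

/-- `g` is a real test function on the set `D`. -/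
structure IsTest (D : Set ℂ) (g : ℂ → ℝ) : Prop where
  contDiff : ContDiff ℝ ∞ g
  hasCompactSupport : HasCompactSupport g
  tsupport_subset : tsupport g ⊆ D

/-- `2 ∂g/∂z̄` for a real-valued function `g`. -/
noncomputable def twoDbar (g : ℂ → ℝ) (z : ℂ) : ℂ :=
  (fderiv ℝ g z 1 : ℂ) + (fderiv ℝ g z Complex.I : ℂ) * Complex.I

/-- `u` is a real potential of `F` on `D` in the weak sense: the distributional derivative of `u`
in the direction `v` is `Re (F v)`; equivalently, `F = 2 ∂u/∂z` in the sense of distributions. -/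
def WeakPotential (D : Set ℂ) (F : ℂ → ℂ) (u : ℂ → ℝ) : Prop :=
  ∀ g, IsTest D g → ∀ v : ℂ, ∫ z, u z * fderiv ℝ g z v = -∫ z, (F z * v).re * g z

/-- `∂F/∂z̄ ≥ 0` on `D` in the sense of distributions, for a locally integrable function `F`. The
sign comes from `⟨∂F/∂z̄, g⟩ = -∫ F ∂g/∂z̄`. -/
structure DbarNonneg (D : Set ℂ) (F : ℂ → ℂ) : Prop where
  re_nonpos : ∀ g, IsTest D g → (∀ z, 0 ≤ g z) → ∫ z, (F z * twoDbar g z).re ≤ 0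
  im_eq_zero : ∀ g, IsTest D g → (∀ z, 0 ≤ g z) → ∫ z, (F z * twoDbar g z).im = 0

theorem IsTest.mono {D D' : Set ℂ} {g : ℂ → ℝ} (hg : IsTest D g) (h : D ⊆ D') : IsTest D' g :=
  ⟨hg.contDiff, hg.hasCompactSupport, hg.tsupport_subset.trans h⟩

theorem IsTest.continuous {D : Set ℂ} {g : ℂ → ℝ} (hg : IsTest D g) : Continuous g :=
  hg.contDiff.continuous

theorem IsTest.fderiv_apply {D : Set ℂ} {g : ℂ → ℝ} (hg : IsTest D g) (v : ℂ) :
    IsTest D (fun z => fderiv ℝ g z v) := by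
  refine ⟨?_, hg.hasCompactSupport.fderiv_apply ℝ v,
    (tsupport_fderiv_apply_subset ℝ v).trans hg.tsupport_subset⟩
  exact (hg.contDiff.fderiv_right (m := ∞) (by simp)).clm_apply contDiff_const

theorem IsTest.integrable_mul {D : Set ℂ} {g f : ℂ → ℝ} (hg : IsTest D g)
    (hf : LocallyIntegrable f) : Integrable (fun z => f z * g z) := by
  simpa [mul_comm] using
    hf.integrable_smul_left_of_hasCompactSupport hg.continuous hg.hasCompactSupport

theorem locallyIntegrable_re_mul {F : ℂ → ℂ} (hF : LocallyIntegrable F) (v : ℂ) :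
    LocallyIntegrable (fun z => (F z * v).re) := by
  intro z
  obtain ⟨s, hs, h⟩ := hF z
  exact ⟨s, hs, (h.mul_const v).re⟩

theorem WeakPotential.mono {D D' : Set ℂ} {F : ℂ → ℂ} {u : ℂ → ℝ} (h : WeakPotential D F u)
    (hD : D' ⊆ D) : WeakPotential D' F u := fun g hg v => h g (hg.mono hD) v

theorem DbarNonneg.mono {D D' : Set ℂ} {F : ℂ → ℂ} (h : DbarNonneg D F)
    (hD : D' ⊆ D) : DbarNonneg D' F :=
  ⟨fun g hg => h.1 g (hg.mono hD), fun g hg => h.2 g (hg.mono hD)⟩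

/-- Integration by parts on an open set against a test function. -/
theorem integral_mul_fderiv_of_contDiffOn {D : Set ℂ} (hD : IsOpen D) {f g : ℂ → ℝ}
    (hf : ContDiffOn ℝ 1 f D) (hg : IsTest D g) (v : ℂ) :
    (Integrable fun z => f z * fderiv ℝ g z v) ∧ (Integrable fun z => fderiv ℝ f z v * g z) ∧
    ∫ z, f z * fderiv ℝ g z v = -∫ z, fderiv ℝ f z v * g z := by
  have key : ∀ (a b : ℂ → ℝ), ContinuousOn a D → IsTest D b →
      Integrable fun z => a z * b z := by
    intro a b ha hb
    refine Continuous.integrable_of_hasCompactSupport ?_ hb.hasCompactSupport.mul_left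
    refine continuous_of_tsupport fun x hx => ?_
    have hxD : x ∈ D := hb.tsupport_subset (tsupport_mul_subset_right hx)
    exact (ha.continuousAt (hD.mem_nhds hxD)).mul hb.continuous.continuousAt
  have hf' : ContinuousOn (fun z => fderiv ℝ f z v) D :=
    (hf.continuousOn_fderiv_of_isOpen hD le_rfl).clm_apply continuousOn_const
  have i1 := key _ _ hf.continuousOn (hg.fderiv_apply v)
  have i2 := key _ _ hf' hg
  refine ⟨i1, i2, integral_mul_fderiv_eq_neg_fderiv_mul_of_integrable i2 i1
    (key _ _ hf.continuousOn hg) (fun x hx => ?_)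
    (fun x _ => hg.contDiff.differentiable (by simp) x)⟩
  exact (hf.differentiableOn (by simp)).differentiableAt (hD.mem_nhds (hg.tsupport_subset hx))

/-- The convolution of `f` with the kernel `ρ`. -/
noncomputable def mollify {E : Type*} [NormedAddCommGroup E] [NormedSpace ℝ E]
    (ρ : ℂ → ℝ) (f : ℂ → E) (x : ℂ) : E := ∫ w, ρ (x - w) • f w

section Mollify

variable {E : Type*} [NormedAddCommGroup E] [NormedSpace ℝ E] {ρ : ℂ → ℝ} {f : ℂ → E}

theorem mollify_eq_convolution (ρ : ℂ → ℝ) (f : ℂ → E) :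
    mollify ρ f = (ρ ⋆[ContinuousLinearMap.lsmul ℝ ℝ, volume] f) := by
  ext x
  rw [convolution_eq_swap]
  rfl

/-- A mollification is differentiated by differentiating the kernel. -/
theorem hasFDerivAt_mollify (hρ : ContDiff ℝ 1 ρ) (hc : HasCompactSupport ρ)
    (hf : LocallyIntegrable f) (x : ℂ) :
    ∃ L : ℂ →L[ℝ] E, HasFDerivAt (mollify ρ f) L x ∧
      ∀ v, L v = ∫ w, fderiv ℝ ρ (x - w) v • f w := by
  rw [mollify_eq_convolution]
  refine ⟨_, hc.hasFDerivAt_convolution_left _ hρ hf x, fun v => ?_⟩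
  have h1 : ConvolutionExistsAt (fderiv ℝ ρ) f x
      (ContinuousLinearMap.precompL ℂ (ContinuousLinearMap.lsmul ℝ ℝ : ℝ →L[ℝ] E →L[ℝ] E))
      volume :=
    (hc.fderiv ℝ).convolutionExists_left _ (hρ.continuous_fderiv (by simp)) hf x
  have h2 := h1.integrable_swap
  rw [convolution_eq_swap, ContinuousLinearMap.integral_apply h2]
  rfl

end Mollify

theorem isTest_sub_left {ρ : ℂ → ℝ} {δ : ℝ} (hρ : ContDiff ℝ ∞ ρ)
    (hsupp : tsupport ρ ⊆ closedBall 0 δ) {x : ℂ} {D : Set ℂ} (hx : closedBall x δ ⊆ D) :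
    IsTest D (fun w => ρ (x - w)) := by
  have hsub : tsupport (fun w => ρ (x - w)) ⊆ closedBall x δ := by
    refine closure_minimal (fun w hw => ?_) isClosed_closedBall
    have h := hsupp (subset_tsupport ρ hw)
    simpa [dist_eq_norm, norm_sub_rev] using h
  refine ⟨hρ.comp (contDiff_const.sub contDiff_id), ?_, hsub.trans hx⟩
  exact HasCompactSupport.intro (isCompact_closedBall x δ)
    fun w hw => by_contra fun h => hw (hsub (subset_tsupport _ h))

theorem fderiv_comp_sub_left_apply {ρ : ℂ → ℝ} (hρ : Differentiable ℝ ρ) (x w v : ℂ) :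
    fderiv ℝ (fun w => ρ (x - w)) w v = -fderiv ℝ ρ (x - w) v := by
  have h : HasFDerivAt (fun w => x - w) (-ContinuousLinearMap.id ℝ ℂ) w :=
    (hasFDerivAt_id w).const_sub x
  have h' := ((hρ (x - w)).hasFDerivAt.comp w h).fderiv
  change fderiv ℝ (fun w => ρ (x - w)) w = _ at h'
  rw [h']
  simp

/-- The smooth bump function around `0` of outer radius `δ` used as a mollifier. -/
noncomputable def bumpAt (δ : ℝ) (hδ : 0 < δ) : ContDiffBump (0 : ℂ) :=
  ⟨δ / 2, δ, by positivity, by linarith⟩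

theorem integral_normed_sub_left {δ : ℝ} (hδ : 0 < δ) (x : ℂ) :
    ∫ w, (bumpAt δ hδ).normed volume (x - w) = 1 := by
  rw [integral_sub_left_eq_self (fun w => (bumpAt δ hδ).normed volume w) volume x]
  exact ContDiffBump.integral_normed _

/-- If `Re (F v) ≥ c` almost everywhere in an open convex set, then there the potential of `F`
grows at least at rate `c` in direction `v`. -/
theorem WeakPotential.add_mul_le {B : Set ℂ} (hBo : IsOpen B) (hBc : Convex ℝ B)
    {F : ℂ → ℂ} (hF : LocallyIntegrable F) {u : ℂ → ℝ} (hu : Continuous u)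
    (hW : WeakPotential B F u) {v : ℂ} {c : ℝ}
    (hv : ∀ᵐ z ∂(volume.restrict B), c ≤ (F z * v).re) {x : ℂ} {t : ℝ} (ht : 0 ≤ t)
    (hx : x ∈ B) (hxt : x + t * v ∈ B) : u x + c * t ≤ u (x + t * v) := by
  -- a compact segment in `B` has a neighbourhood of fixed width in `B`
  have hseg : segment ℝ x (x + t * v) ⊆ B := hBc.segment_subset hx hxt
  have hcomp : IsCompact (segment ℝ x (x + t * v)) := by
    rw [segment_eq_image_lineMap]
    exact isCompact_Icc.image (by fun_prop)
  obtain ⟨δ₀, hδ₀, hδB⟩ := hcomp.exists_cthickening_subset_open hBo hseg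
  have hball : ∀ s ∈ Icc 0 t, closedBall (x + s * v) δ₀ ⊆ B := by
    intro s hs
    refine (closedBall_subset_cthickening ?_ δ₀).trans hδB
    rcases eq_or_lt_of_le ht with rfl | ht'
    · have : s = 0 := le_antisymm hs.2 hs.1
      subst this; simp
    · rw [segment_eq_image']
      refine ⟨s / t, ⟨div_nonneg hs.1 ht, div_le_one_of_le₀ hs.2 ht⟩, ?_⟩
      simp only [add_sub_cancel_left, Complex.real_smul]
      have : (t : ℂ) ≠ 0 := by exact_mod_cast ht'.ne'
      push_cast
      field_simp
  -- the inequality for mollifications at scale at most `δ₀`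
  have main : ∀ δ (hδ : 0 < δ), δ ≤ δ₀ →
      mollify ((bumpAt δ hδ).normed volume) u x + c * t ≤
        mollify ((bumpAt δ hδ).normed volume) u (x + t * v) := by
    intro δ hδ hle
    set ρ := (bumpAt δ hδ).normed volume with hρdef
    have hρ : ContDiff ℝ ∞ ρ := ContDiffBump.contDiff_normed _
    have hρc : HasCompactSupport ρ := ContDiffBump.hasCompactSupport_normed _
    have hρt : tsupport ρ ⊆ closedBall 0 δ := by
      rw [hρdef, ContDiffBump.tsupport_normed_eq]; rfl
    have hder : ∀ s ∈ Icc 0 t, ∃ d, HasDerivAt (fun s : ℝ => mollify ρ u (x + s * v)) d s ∧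
        c ≤ d := by
      intro s hs
      obtain ⟨L, hL, hLv⟩ := hasFDerivAt_mollify (hρ.of_le (by simp)) hρc
        (hu.locallyIntegrable (μ := volume)) (x + s * v)
      have hlin : HasDerivAt (fun s : ℝ => x + s * v) v s := by
        simpa using ((Complex.ofRealCLM.hasDerivAt (x := s)).mul_const v).const_add x
      refine ⟨L v, HasFDerivAt.comp_hasDerivAt (f := fun s : ℝ => x + s * v) s hL hlin, ?_⟩
      have htest : IsTest B (fun w => ρ (x + s * v - w)) :=
        isTest_sub_left hρ hρt ((closedBall_subset_closedBall hle).trans (hball s hs))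
      have h := hW _ htest v
      simp only [fderiv_comp_sub_left_apply (hρ.differentiable (by simp)), mul_neg,
        integral_neg, neg_inj] at h
      have hLv' : L v = ∫ w, (F w * v).re * ρ (x + s * v - w) := by
        rw [hLv, ← h]; simp [mul_comm]
      have hc : c = ∫ w, c * ρ (x + s * v - w) := by
        rw [integral_const_mul, integral_normed_sub_left, mul_one]
      rw [hLv', hc]
      refine integral_mono_ae ?_ (htest.integrable_mul (locallyIntegrable_re_mul hF v)) ?_
      · exact (htest.continuous.integrable_of_hasCompactSupport htest.hasCompactSupport).const_mul c
      · have hv' := (ae_restrict_iff' hBo.measurableSet).1 hv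
        filter_upwards [hv'] with w hw
        by_cases hwB : w ∈ B
        · exact mul_le_mul_of_nonneg_right (hw hwB) (ContDiffBump.nonneg_normed _ _)
        · have : ρ (x + s * v - w) = 0 :=
            image_eq_zero_of_notMem_tsupport (f := fun w => ρ (x + s * v - w))
              fun h => hwB (htest.tsupport_subset h)
          simp [this]
    choose! d hd hcd using hder
    have hmono : MonotoneOn (fun s : ℝ => mollify ρ u (x + s * v) - c * s) (Icc 0 t) := by
      refine monotoneOn_of_hasDerivWithinAt_nonneg (f' := fun s => d s - c) (convex_Icc 0 t) ?_ ?_ ?_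
      · intro s hs
        exact ((hd s hs).continuousAt.sub (by fun_prop)).continuousWithinAt
      · intro s hs
        have := (hd s (interior_subset hs)).fun_sub ((hasDerivAt_id s).const_mul c)
        rw [mul_one] at this
        exact this.hasDerivWithinAt
      · intro s hs
        exact sub_nonneg.2 (hcd s (interior_subset hs))
    have := hmono (left_mem_Icc.2 ht) (right_mem_Icc.2 ht) ht
    simp only [Complex.ofReal_zero, zero_mul, add_zero, mul_zero, sub_zero] at this
    linarith
  -- pass to the limit
  have hδn : ∀ n : ℕ, 0 < δ₀ / (n + 1) := fun n => by positivity
  have hlim : ∀ y, Tendsto (fun n : ℕ => mollify ((bumpAt _ (hδn n)).normed volume) u y) atTop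
      (𝓝 (u y)) := by
    intro y
    simp only [mollify_eq_convolution]
    refine ContDiffBump.convolution_tendsto_right_of_continuous ?_ hu y
    simpa [bumpAt, div_eq_mul_inv] using tendsto_one_div_add_atTop_nhds_zero_nat.const_mul δ₀
  refine le_of_tendsto_of_tendsto' ((hlim x).add_const _) (hlim _) fun n => main _ (hδn n) ?_
  exact div_le_self hδ₀.le (by linarith [n.cast_nonneg (α := ℝ)])

/-! ### Existence of potentials -/

/-- The real bilinear form `(a, v) ↦ Re (a v)` on `ℂ`. -/
noncomputable def reMul : ℂ →L[ℝ] ℂ →L[ℝ] ℝ :=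
  (ContinuousLinearMap.compL ℝ ℂ ℂ ℝ Complex.reCLM).comp (ContinuousLinearMap.mul ℝ ℂ)

@[simp] theorem reMul_apply (a v : ℂ) : reMul a v = (a * v).re := rfl

theorem norm_reMul_le (a : ℂ) : ‖reMul a‖ ≤ ‖a‖ :=
  ContinuousLinearMap.opNorm_le_bound _ (norm_nonneg _) fun v =>
    (Complex.abs_re_le_norm _).trans (norm_mul a v).le

/-- The `1`-form `Re (f dz)` is closed when `∂f/∂z̄` is real; `L` is the real derivative of `f` at
a point. -/
theorem re_apply_mul_comm {L : ℂ →L[ℝ] ℂ} (h : (L 1 + L Complex.I * Complex.I).im = 0)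
    (x y : ℂ) : (L x * y).re = (L y * x).re := by
  have key : ∀ x : ℂ, L x = x.re • L 1 + x.im • L Complex.I := by
    intro x
    rw [← map_smul, ← map_smul, ← map_add]
    congr 1
    apply Complex.ext <;> simp
  rw [key x, key y]
  simp only [Complex.add_im, Complex.mul_im, Complex.I_re, Complex.I_im] at h
  simp only [Complex.add_re, Complex.mul_re, Complex.add_im, Complex.smul_re, Complex.smul_im,
    smul_eq_mul]
  linear_combination (x.re * y.im - x.im * y.re) * (-h)

theorem norm_mollify_le {F : ℂ → ℂ} {C : ℝ} (hFC : ∀ z, ‖F z‖ ≤ C) {δ : ℝ} (hδ : 0 < δ) (x : ℂ) :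
    ‖mollify ((bumpAt δ hδ).normed volume) F x‖ ≤ C := by
  have hi : Integrable fun w => (bumpAt δ hδ).normed volume (x - w) :=
    (ContDiffBump.integrable_normed (bumpAt δ hδ)).comp_sub_left x
  calc ‖mollify ((bumpAt δ hδ).normed volume) F x‖
      ≤ ∫ w, (bumpAt δ hδ).normed volume (x - w) * C := by
        refine norm_integral_le_of_norm_le (hi.mul_const C) (ae_of_all _ fun w => ?_)
        rw [norm_smul, Real.norm_of_nonneg (ContDiffBump.nonneg_normed _ _)]
        exact mul_le_mul_of_nonneg_left (hFC w) (ContDiffBump.nonneg_normed _ _)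
    _ = C := by rw [integral_mul_const, integral_normed_sub_left, one_mul]

/-- The Lipschitz functions with a fixed constant that vanish at a point form a compact set. -/
theorem isCompact_setOf_lipschitzWith (C : ℝ≥0) (p : ℂ) :
    IsCompact {f : C(ℂ, ℝ) | LipschitzWith C f ∧ f p = 0} := by
  refine ArzelaAscoli.isCompact_of_equicontinuous _ ?_ ?_
  · have him : ContinuousMap.toFun '' {f : C(ℂ, ℝ) | LipschitzWith C f ∧ f p = 0} =
        {f : ℂ → ℝ | LipschitzWith C f} ∩ {f | f p = 0} := by
      ext f
      constructor
      · rintro ⟨g, hg, rfl⟩; exact hg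
      · rintro ⟨h1, h2⟩; exact ⟨⟨f, h1.continuous⟩, ⟨h1, h2⟩, rfl⟩
    rw [him]
    have hcl : IsClosed ({f : ℂ → ℝ | LipschitzWith C f} ∩ {f | f p = 0}) :=
      (isClosed_setOfPred_lipschitzWith C).inter
        (isClosed_eq (continuous_apply p) continuous_const)
    refine (isCompact_univ_pi fun z => isCompact_Icc (a := -(C * dist z p))
      (b := C * dist z p)).of_isClosed_subset hcl ?_
    rintro f ⟨h1, h2⟩ z -
    have h := h1.dist_le_mul z p
    rw [h2, Real.dist_eq, sub_zero] at h
    exact abs_le.1 h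
  · exact (LipschitzWith.uniformEquicontinuous _ C fun f => f.2.1).equicontinuous

/-- Primitives of closed `1`-forms `Re (F dz)` for smooth bounded `F`, extended to the plane as
Lipschitz functions. -/
theorem exists_lipschitz_primitive {F : ℂ → ℂ} {C : ℝ≥0} (hFC : ∀ z, ‖F z‖ ≤ C)
    (hF : ContDiff ℝ 1 F) {p : ℂ} {R : ℝ}
    (hcl : ∀ x ∈ ball p R, (fderiv ℝ F x 1 + fderiv ℝ F x Complex.I * Complex.I).im = 0) :
    ∃ u : ℂ → ℝ, LipschitzWith C u ∧ u p = 0 ∧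
      ∀ x ∈ ball p R, HasFDerivAt u (reMul (F x)) x := by
  have hform : ∀ x, HasFDerivAt (fun x => reMul (F x)) (reMul.comp (fderiv ℝ F x)) x := fun x =>
    reMul.hasFDerivAt.comp x (hF.differentiable (by simp) x).hasFDerivAt
  have hdiff : DifferentiableOn ℝ (fun x => reMul (F x)) (ball p R) :=
    fun x _ => (hform x).differentiableAt.differentiableWithinAt
  obtain ⟨f, hf⟩ := (convex_ball p R).exists_forall_hasFDerivAt_of_fderiv_symmetric isOpen_ball
    hdiff fun a ha x y => by
      rw [(hform a).fderiv]
      exact re_apply_mul_comm (hcl a ha) x y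
  have hlip : LipschitzOnWith C f (ball p R) := by
    refine (convex_ball p R).lipschitzOnWith_of_nnnorm_hasFDerivWithin_le
      (fun x hx => (hf x hx).hasFDerivWithinAt) fun x _ => ?_
    exact (norm_reMul_le _).trans (hFC x)
  obtain ⟨g, hg, hfg⟩ := hlip.extend_real
  refine ⟨fun x => g x - g p, ?_, sub_self _, fun x hx => ?_⟩
  · refine LipschitzWith.of_dist_le_mul fun x y => ?_
    simpa using hg.dist_le_mul x y
  · refine ((hf x hx).congr_of_eventuallyEq ?_).sub_const _
    filter_upwards [isOpen_ball.mem_nhds hx] with y hy using (hfg hy).symm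

/-- A bounded function `F` on a disc such that `∂F/∂z̄` is real has a Lipschitz potential on each
smaller concentric disc: the mollifications of `F` have potentials by the Poincaré lemma, and the
Arzelà–Ascoli theorem provides a limit. -/
theorem exists_weakPotential {F : ℂ → ℂ} (hFm : Measurable F) {C : ℝ≥0} (hFC : ∀ z, ‖F z‖ ≤ C)
    {p : ℂ} {R R' : ℝ} (hR : R' < R) (hF : DbarNonneg (ball p R) F) :
    ∃ u : ℂ → ℝ, Continuous u ∧ u p = 0 ∧ WeakPotential (ball p R') F u := by
  have hFl : LocallyIntegrable F volume := by
    have : LocallyIntegrable (fun _ : ℂ => (C : ℝ)) volume := locallyIntegrable_const _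
    refine this.mono hFm.aestronglyMeasurable (ae_of_all _ fun z => ?_)
    simpa using hFC z
  have hδ : ∀ n : ℕ, 0 < (R - R') / (n + 1) := fun n => by
    have := sub_pos.2 hR
    positivity
  set ρ : ℕ → ℂ → ℝ := fun n => (bumpAt _ (hδ n)).normed volume with hρdef
  have hρ : ∀ n, ContDiff ℝ ∞ (ρ n) := fun n => ContDiffBump.contDiff_normed _
  have hρc : ∀ n, HasCompactSupport (ρ n) := fun n => ContDiffBump.hasCompactSupport_normed _
  have hρt : ∀ n, tsupport (ρ n) ⊆ closedBall 0 ((R - R') / (n + 1)) := fun n => by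
    rw [hρdef, ContDiffBump.tsupport_normed_eq]; rfl
  have hFn : ∀ n, ContDiff ℝ 1 (mollify (ρ n) F) := fun n => by
    rw [mollify_eq_convolution]
    exact (hρc n).contDiff_convolution_left _ ((hρ n).of_le (by simp)) hFl
  have hcl : ∀ n, ∀ x ∈ ball p R', (fderiv ℝ (mollify (ρ n) F) x 1 +
      fderiv ℝ (mollify (ρ n) F) x Complex.I * Complex.I).im = 0 := by
    intro n x hx
    obtain ⟨L, hL, hLv⟩ := hasFDerivAt_mollify ((hρ n).of_le (by simp)) (hρc n) hFl x
    have hsub : closedBall x ((R - R') / (n + 1)) ⊆ ball p R := by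
      intro z hz
      have h1 : (R - R') / (n + 1) ≤ R - R' :=
        div_le_self (sub_pos.2 hR).le (by linarith [n.cast_nonneg (α := ℝ)])
      have h2 := dist_triangle z x p
      rw [mem_closedBall] at hz
      rw [mem_ball] at hx ⊢
      linarith
    have htest := isTest_sub_left (hρ n) (hρt n) hsub
    have h := hF.im_eq_zero _ htest fun z => ContDiffBump.nonneg_normed _ _
    have hint : ∀ v, Integrable fun w => fderiv ℝ (ρ n) (x - w) v • F w := by
      intro v
      have := (htest.fderiv_apply v)
      have h2 := hFl.integrable_smul_left_of_hasCompactSupport this.continuous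
        this.hasCompactSupport
      simp only [fderiv_comp_sub_left_apply ((hρ n).differentiable (by simp)), neg_smul] at h2
      simpa using h2.neg
    rw [hL.fderiv, hLv, hLv, ← integral_mul_const, ← integral_add (hint 1) ((hint _).mul_const _)]
    have him := Complex.imCLM.integral_comp_comm
      ((hint 1).add ((hint Complex.I).mul_const Complex.I))
    simp only [Complex.imCLM_apply, Pi.add_apply] at him
    rw [← him, ← neg_eq_zero, ← integral_neg, ← h]
    congr 1
    ext w
    simp only [twoDbar, fderiv_comp_sub_left_apply ((hρ n).differentiable (by simp)),
      Complex.real_smul, ← Complex.neg_im]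
    congr 1
    push_cast
    ring
  choose u hu hup hud using fun n =>
    exists_lipschitz_primitive (norm_mollify_le hFC (hδ n)) (hFn n) (hcl n)
  obtain ⟨U, ⟨hUl, hUp⟩, φ, hφ, hlim⟩ := (isCompact_setOf_lipschitzWith C p).tendsto_subseq
    (x := fun n => ⟨u n, (hu n).continuous⟩) fun n => ⟨hu n, hup n⟩
  refine ⟨U, U.continuous, hUp, fun g hg v => ?_⟩
  have hpt : ∀ z, Tendsto (fun n => u (φ n) z) atTop (𝓝 (U z)) := fun z =>
    ((continuous_eval_const z).tendsto U).comp hlim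
  have hbd : ∀ n z, ‖u n z‖ ≤ C * dist z p := fun n z => by
    have := (hu n).dist_le_mul z p
    rwa [hup, dist_zero_right] at this
  have hgv := hg.fderiv_apply v
  -- the identity for the mollifications, to which dominated convergence is applied on both sides
  have hn : ∀ n, ∫ z, u n z * fderiv ℝ g z v = -∫ z, (mollify (ρ n) F z * v).re * g z := by
    intro n
    have hcd : ContDiffOn ℝ 1 (u n) (ball p R') := by
      refine (contDiffOn_succ_iff_fderiv_of_isOpen (n := 0) isOpen_ball).2
        ⟨fun x hx => (hud n x hx).differentiableAt.differentiableWithinAt, by simp, ?_⟩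
      refine contDiffOn_zero.2 ?_
      refine ((reMul.continuous.comp (hFn n).continuous).continuousOn).congr fun x hx => ?_
      exact (hud n x hx).fderiv
    rw [(integral_mul_fderiv_of_contDiffOn isOpen_ball hcd hg v).2.2]
    congr 1
    refine integral_congr_ae (ae_of_all _ fun z => ?_)
    by_cases hz : z ∈ ball p R'
    · simp only [(hud n z hz).fderiv, reMul_apply]; rfl
    · have : g z = 0 := image_eq_zero_of_notMem_tsupport fun h => hz (hg.tsupport_subset h)
      simp [this]
  have hlim1 : Tendsto (fun n => ∫ z, u (φ n) z * fderiv ℝ g z v) atTop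
      (𝓝 (∫ z, U z * fderiv ℝ g z v)) := by
    refine tendsto_integral_of_dominated_convergence
      (fun z => C * dist z p * ‖fderiv ℝ g z v‖) (fun n => ?_) ?_ (fun n => ?_) ?_
    · exact ((hu _).continuous.mul hgv.continuous).aestronglyMeasurable
    · refine Continuous.integrable_of_hasCompactSupport ?_ hgv.hasCompactSupport.norm.mul_left
      have := hgv.continuous
      fun_prop
    · exact ae_of_all _ fun z => by
        rw [norm_mul]; exact mul_le_mul_of_nonneg_right (hbd _ z) (norm_nonneg _)
    · exact ae_of_all _ fun z => (hpt z).mul_const _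
  have hlim2 : Tendsto (fun n => ∫ z, (mollify (ρ (φ n)) F z * v).re * g z) atTop
      (𝓝 (∫ z, (F z * v).re * g z)) := by
    refine tendsto_integral_of_dominated_convergence
      (fun z => C * ‖v‖ * ‖g z‖) (fun n => ?_) ?_ (fun n => ?_) ?_
    · exact ((Complex.continuous_re.comp ((hFn _).continuous.mul continuous_const)).mul
        hg.continuous).aestronglyMeasurable
    · exact ((hg.continuous.integrable_of_hasCompactSupport hg.hasCompactSupport).norm).const_mul _
    · refine ae_of_all _ fun z => ?_
      rw [norm_mul]
      refine mul_le_mul_of_nonneg_right ?_ (norm_nonneg _)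
      refine (Complex.abs_re_le_norm _).trans ?_
      rw [norm_mul]
      exact mul_le_mul_of_nonneg_right (norm_mollify_le hFC _ z) (norm_nonneg _)
    · have hae := ContDiffBump.ae_convolution_tendsto_right_of_locallyIntegrable
        (φ := fun n => bumpAt _ (hδ (φ n))) (l := atTop) (K := 2) (μ := volume) ?_ ?_ hFl
      · filter_upwards [hae] with z hz
        simp only [hρdef, mollify_eq_convolution]
        exact ((Complex.continuous_re.tendsto _).comp (hz.mul_const v)).mul_const _
      · have : Tendsto (fun n : ℕ => (R - R') / ((n : ℝ) + 1)) atTop (𝓝 0) := by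
          simpa [div_eq_mul_inv] using
            tendsto_one_div_add_atTop_nhds_zero_nat.const_mul (R - R')
        exact this.comp hφ.tendsto_atTop
      · refine Eventually.of_forall fun n => ?_
        simp only [bumpAt]; linarith
  refine tendsto_nhds_unique hlim1 ?_
  simp only [hn]
  exact hlim2.neg

/-! ### Subharmonic functions and the strong maximum principle -/

/-- The Laplacian of a real-valued function on the plane. -/
noncomputable def lap (g : ℂ → ℝ) (z : ℂ) : ℝ :=
  fderiv ℝ (fun w => fderiv ℝ g w 1) z 1 +
    fderiv ℝ (fun w => fderiv ℝ g w Complex.I) z Complex.I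

/-- `u` is subharmonic on `D` in the sense of distributions. -/
def WeakSubharmonic (D : Set ℂ) (u : ℂ → ℝ) : Prop :=
  ∀ g, IsTest D g → (∀ z, 0 ≤ g z) → 0 ≤ ∫ z, u z * lap g z

/-- The potential of a function with nonnegative `z̄`-derivative is subharmonic. -/
theorem WeakPotential.weakSubharmonic {D : Set ℂ} {F : ℂ → ℂ} {u : ℂ → ℝ}
    (hFl : LocallyIntegrable F) (hu : Continuous u) (hW : WeakPotential D F u)
    (hF : DbarNonneg D F) : WeakSubharmonic D u := by
  intro g hg h0
  have h1 := hW _ (hg.fderiv_apply 1) 1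
  have h2 := hW _ (hg.fderiv_apply Complex.I) Complex.I
  have h3 := hF.re_nonpos g hg h0
  have hi : ∀ v w : ℂ, Integrable fun z => u z * fderiv ℝ (fun x => fderiv ℝ g x v) z w :=
    fun v w => ((hg.fderiv_apply v).fderiv_apply w).integrable_mul hu.locallyIntegrable
  have hj : ∀ v : ℂ, Integrable fun z => (F z * v).re * fderiv ℝ g z v :=
    fun v => (hg.fderiv_apply v).integrable_mul (locallyIntegrable_re_mul hFl v)
  have : ∫ z, u z * lap g z = -∫ z, (F z * twoDbar g z).re := by
    simp only [lap, mul_add]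
    rw [integral_add (hi _ _) (hi _ _), h1, h2, ← neg_add, ← integral_add (hj _) (hj _)]
    congr 2
    ext z
    simp [twoDbar]
    ring
  linarith

theorem WeakSubharmonic.mono {D D' : Set ℂ} {u : ℂ → ℝ} (h : WeakSubharmonic D u) (hD : D' ⊆ D) :
    WeakSubharmonic D' u := fun g hg => h g (hg.mono hD)

/-- The flat function `s ↦ exp (-l / s)` for `s > 0`, extended by `0`. -/
noncomputable def flat (l s : ℝ) : ℝ := expNegInvGlue (s / l)

section Flat

variable {l : ℝ}

theorem contDiff_flat : ContDiff ℝ ∞ (flat l) :=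
  expNegInvGlue.contDiff.comp (contDiff_id.div_const l)

theorem flat_nonneg (s : ℝ) : 0 ≤ flat l s := expNegInvGlue.nonneg _

theorem flat_of_nonpos (hl : 0 < l) {s : ℝ} (hs : s ≤ 0) : flat l s = 0 :=
  expNegInvGlue.zero_of_nonpos (div_nonpos_of_nonpos_of_nonneg hs hl.le)

theorem flat_of_pos (hl : 0 < l) {s : ℝ} (hs : 0 < s) : flat l s = Real.exp (-(l * s⁻¹)) := by
  have : ¬ s / l ≤ 0 := not_le.2 (div_pos hs hl)
  rw [flat, expNegInvGlue, if_neg this, inv_div, div_eq_mul_inv]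

theorem contDiff_deriv_flat : ContDiff ℝ ∞ (deriv (flat l)) :=
  (contDiff_infty_iff_deriv.1 contDiff_flat).2

theorem deriv_eq_zero_of_nonpos {f : ℝ → ℝ} (hf : ContDiff ℝ ∞ f) (h0 : ∀ s ≤ 0, f s = 0) :
    ∀ s ≤ 0, deriv f s = 0 := by
  have hneg : Iio (0 : ℝ) ⊆ {s | deriv f s = 0} := by
    intro s hs
    have : f =ᶠ[𝓝 s] fun _ => 0 := by
      filter_upwards [isOpen_Iio.mem_nhds hs] with x hx using h0 x (le_of_lt hx)
    simp [this.deriv_eq]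
  have hcl : IsClosed {s | deriv f s = 0} :=
    isClosed_eq (contDiff_infty_iff_deriv.1 hf).2.continuous continuous_const
  intro s hs
  have := closure_minimal hneg hcl
  rw [closure_Iio] at this
  exact this hs

theorem deriv_flat_of_pos (hl : 0 < l) {s : ℝ} (hs : 0 < s) :
    deriv (flat l) s = l / s ^ 2 * Real.exp (-(l * s⁻¹)) := by
  have he : flat l =ᶠ[𝓝 s] fun x => Real.exp (-(l * x⁻¹)) := by
    filter_upwards [isOpen_Ioi.mem_nhds hs] with x hx using flat_of_pos hl hx
  rw [he.deriv_eq]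
  have h := (((hasDerivAt_inv hs.ne').const_mul l).fun_neg).exp
  refine h.deriv.trans ?_
  field_simp

theorem deriv_deriv_flat_of_pos (hl : 0 < l) {s : ℝ} (hs : 0 < s) :
    deriv (deriv (flat l)) s = (l ^ 2 / s ^ 4 - 2 * l / s ^ 3) * Real.exp (-(l * s⁻¹)) := by
  have he : deriv (flat l) =ᶠ[𝓝 s] fun x => l / x ^ 2 * Real.exp (-(l * x⁻¹)) := by
    filter_upwards [isOpen_Ioi.mem_nhds hs] with x hx using deriv_flat_of_pos hl hx
  rw [he.deriv_eq]
  have h := (((hasDerivAt_inv hs.ne').const_mul l).neg).exp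
  have h2 := (((hasDerivAt_pow 2 s).inv (pow_ne_zero 2 hs.ne')).const_mul l).mul h
  have h3 : (fun x => l / x ^ 2 * Real.exp (-(l * x⁻¹))) =
      (fun y => l * (y ^ 2)⁻¹) * fun x => Real.exp (-(l * x⁻¹)) := by
    ext x; simp [div_eq_mul_inv]
  rw [h3]
  refine h2.deriv.trans ?_
  simp
  field_simp
  ring

end Flat

/-- The function `R² - |z - q|²`, positive exactly on the disc of radius `R` about `q`. -/
def discFun (q : ℂ) (R : ℝ) (z : ℂ) : ℝ := R ^ 2 - ((z.re - q.re) ^ 2 + (z.im - q.im) ^ 2)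

theorem discFun_eq (q : ℂ) (R : ℝ) (z : ℂ) : discFun q R z = R ^ 2 - dist z q ^ 2 := by
  rw [Complex.dist_eq, Complex.sq_norm, Complex.normSq_apply]
  simp [discFun]; ring

/-- The radial barrier function supported in the closed disc of radius `R` about `q`. -/
noncomputable def barrier (q : ℂ) (R l : ℝ) (z : ℂ) : ℝ := flat l (discFun q R z)

theorem contDiff_discFun (q : ℂ) (R : ℝ) : ContDiff ℝ ∞ (discFun q R) := by
  have h1 : ContDiff ℝ ∞ (fun z : ℂ => z.re) := Complex.reCLM.contDiff
  have h2 : ContDiff ℝ ∞ (fun z : ℂ => z.im) := Complex.imCLM.contDiff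
  exact contDiff_const.sub (((h1.sub contDiff_const).pow 2).add ((h2.sub contDiff_const).pow 2))

theorem fderiv_comp_discFun {f : ℝ → ℝ} (hf : Differentiable ℝ f) (q : ℂ) (R : ℝ) (z v : ℂ) :
    fderiv ℝ (fun w => f (discFun q R w)) z v = deriv f (discFun q R z) *
      (-2 * ((z.re - q.re) * v.re + (z.im - q.im) * v.im)) := by
  have h1 : HasFDerivAt (fun z : ℂ => z.re - q.re) Complex.reCLM z :=
    Complex.reCLM.hasFDerivAt.sub_const _
  have h2 : HasFDerivAt (fun z : ℂ => z.im - q.im) Complex.imCLM z :=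
    Complex.imCLM.hasFDerivAt.sub_const _
  have h3 := ((h1.pow 2).fun_add (h2.pow 2)).const_sub (R ^ 2)
  have h4 := (hf (discFun q R z)).hasDerivAt.comp_hasFDerivAt z h3
  change HasFDerivAt (fun w => f (discFun q R w)) _ z at h4
  rw [h4.fderiv]
  simp
  ring

theorem lap_barrier (q : ℂ) (R l : ℝ) (z : ℂ) :
    lap (barrier q R l) z = 4 * deriv (deriv (flat l)) (discFun q R z) * dist z q ^ 2
      - 4 * deriv (flat l) (discFun q R z) := by
  have hf := (contDiff_flat (l := l)).differentiable (by simp)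
  have hf' := (contDiff_deriv_flat (l := l)).differentiable (by simp)
  have e : ∀ v w, fderiv ℝ (barrier q R l) w v = deriv (flat l) (discFun q R w) *
      (-2 * ((w.re - q.re) * v.re + (w.im - q.im) * v.im)) :=
    fun v w => fderiv_comp_discFun hf q R w v
  have hd : ∀ v z, fderiv ℝ (fun w => fderiv ℝ (barrier q R l) w v) z v =
      4 * deriv (deriv (flat l)) (discFun q R z) *
        ((z.re - q.re) * v.re + (z.im - q.im) * v.im) ^ 2 -
        2 * deriv (flat l) (discFun q R z) * (v.re ^ 2 + v.im ^ 2) := by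
    intro v z
    simp only [e]
    have g1 : DifferentiableAt ℝ (fun w => deriv (flat l) (discFun q R w)) z :=
      (hf'.comp ((contDiff_discFun q R).differentiable (by simp))) z
    have g2 : HasFDerivAt
        (fun w : ℂ => -2 * ((w.re - q.re) * v.re + (w.im - q.im) * v.im))
        ((-2 : ℝ) • (v.re • Complex.reCLM + v.im • Complex.imCLM)) z := by
      have h1 : HasFDerivAt (fun z : ℂ => z.re - q.re) Complex.reCLM z :=
        Complex.reCLM.hasFDerivAt.sub_const _
      have h2 : HasFDerivAt (fun z : ℂ => z.im - q.im) Complex.imCLM z :=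
        Complex.imCLM.hasFDerivAt.sub_const _
      exact ((h1.mul_const v.re).fun_add (h2.mul_const v.im)).const_mul (-2)
    have g3 := (g1.hasFDerivAt.fun_mul g2).fderiv
    rw [g3]
    have e2 := fderiv_comp_discFun hf' q R z v
    simp only [add_apply, smul_apply, e2,
      Complex.reCLM_apply, Complex.imCLM_apply, smul_eq_mul]
    ring
  rw [lap, hd, hd, Complex.dist_eq, Complex.sq_norm, Complex.normSq_apply]
  simp
  ring

theorem isTest_barrier {q : ℂ} {R l : ℝ} (hl : 0 < l) (hR : 0 ≤ R) {D : Set ℂ}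
    (hD : closedBall q R ⊆ D) : IsTest D (barrier q R l) := by
  have hz : ∀ z, z ∉ closedBall q R → barrier q R l z = 0 := by
    intro z hz
    refine flat_of_nonpos hl ?_
    rw [mem_closedBall, not_le] at hz
    rw [discFun_eq]
    nlinarith
  refine ⟨contDiff_flat.comp (contDiff_discFun q R),
    HasCompactSupport.intro (isCompact_closedBall q R) hz, ?_⟩
  refine (closure_minimal (fun z hz' => ?_) isClosed_closedBall).trans hD
  by_contra h
  exact hz' (hz z h)

/-- For large `l` the Laplacian of the barrier is positive on the annulus `δ ≤ |z - q| < R`: with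
`s = R² - |z - q|²` its sign is that of `(l - 2 s) |z - q|² - s²`. -/
theorem lap_barrier_pos {q z : ℂ} {R l δ : ℝ} (hδ : 0 < δ)
    (hl : 2 * R ^ 2 + (R ^ 4 + 1) / δ ^ 2 ≤ l) (hz : δ ≤ dist z q) (hzR : dist z q < R) :
    0 < lap (barrier q R l) z := by
  have hR : 0 < R := dist_nonneg.trans_lt hzR
  have hl0 : 0 < l := lt_of_lt_of_le (by positivity) hl
  have hs : 0 < discFun q R z := by
    rw [discFun_eq]; nlinarith [dist_nonneg (x := z) (y := q)]
  have hsR : discFun q R z ≤ R ^ 2 := by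
    rw [discFun_eq]; nlinarith [sq_nonneg (dist z q)]
  rw [lap_barrier, deriv_deriv_flat_of_pos hl0 hs, deriv_flat_of_pos hl0 hs]
  generalize discFun q R z = s at *
  have hd : δ ^ 2 ≤ dist z q ^ 2 := pow_le_pow_left₀ hδ.le hz 2
  have h1 : (R ^ 4 + 1) / δ ^ 2 ≤ l - 2 * s := by linarith
  have h2 : R ^ 4 + 1 ≤ (l - 2 * s) * δ ^ 2 := (div_le_iff₀ (by positivity)).1 h1
  have h3 : s ^ 2 < (l - 2 * s) * dist z q ^ 2 := by
    have h4 : 0 ≤ l - 2 * s := le_trans (by positivity) h1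
    have h5 : s ^ 2 ≤ R ^ 4 := by nlinarith
    nlinarith [mul_le_mul_of_nonneg_left hd h4]
  have : 4 * ((l ^ 2 / s ^ 4 - 2 * l / s ^ 3) * Real.exp (-(l * s⁻¹))) * dist z q ^ 2 -
      4 * (l / s ^ 2 * Real.exp (-(l * s⁻¹))) =
      4 * l / s ^ 4 * Real.exp (-(l * s⁻¹)) * ((l - 2 * s) * dist z q ^ 2 - s ^ 2) := by
    field_simp
  rw [this]
  exact mul_pos (by positivity) (sub_pos.2 h3)

theorem lap_barrier_of_le {q z : ℂ} {R l : ℝ} (hl : 0 < l) (hR : 0 ≤ R) (hzR : R ≤ dist z q) :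
    lap (barrier q R l) z = 0 := by
  have hs : discFun q R z ≤ 0 := by
    rw [discFun_eq]; nlinarith
  have h1 := deriv_eq_zero_of_nonpos (contDiff_flat (l := l)) fun s hs => flat_of_nonpos hl hs
  rw [lap_barrier, h1 _ hs, deriv_eq_zero_of_nonpos contDiff_deriv_flat h1 _ hs]
  simp

/-- A nonpositive subharmonic function on a disc that vanishes near the centre vanishes
identically: test against a barrier whose Laplacian is positive away from the centre. -/
theorem WeakSubharmonic.eq_zero_of_ball {u : ℂ → ℝ} (hu : Continuous u) {q : ℂ} {R δ : ℝ}
    (hδ : 0 < δ) (hsub : WeakSubharmonic (closedBall q R) u) (hle : ∀ z ∈ ball q R, u z ≤ 0)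
    (h0 : ∀ z ∈ ball q δ, u z = 0) : ∀ z ∈ ball q R, u z = 0 := by
  intro z hz
  by_cases hzδ : z ∈ ball q δ
  · exact h0 z hzδ
  have hR : 0 < R := dist_nonneg.trans_lt hz
  set l := 2 * R ^ 2 + (R ^ 4 + 1) / δ ^ 2 with hl
  have hl0 : 0 < l := by positivity
  have htest := isTest_barrier (q := q) hl0 hR.le (D := closedBall q R) subset_rfl
  have hint := hsub _ htest fun z => flat_nonneg _
  have hlap : Continuous (lap (barrier q R l)) :=
    (((htest.fderiv_apply 1).fderiv_apply 1).continuous).add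
      ((htest.fderiv_apply Complex.I).fderiv_apply Complex.I).continuous
  have hnonpos : ∀ w, u w * lap (barrier q R l) w ≤ 0 := by
    intro w
    by_cases h1 : R ≤ dist w q
    · rw [lap_barrier_of_le hl0 hR.le h1, mul_zero]
    · by_cases h2 : w ∈ ball q δ
      · rw [h0 w h2, zero_mul]
      · exact mul_nonpos_of_nonpos_of_nonneg (hle w (not_le.1 h1))
          (lap_barrier_pos hδ le_rfl (not_lt.1 h2) (not_le.1 h1)).le
  have hcont : Continuous fun w => -(u w * lap (barrier q R l) w) := (hu.mul hlap).neg
  by_contra hne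
  have hpos : 0 < ∫ w, -(u w * lap (barrier q R l) w) := by
    refine hcont.integral_pos_of_hasCompactSupport_nonneg_nonzero ?_
      (fun w => neg_nonneg.2 (hnonpos w)) (x := z) ?_
    · refine HasCompactSupport.intro (isCompact_closedBall q R) fun w hw => ?_
      rw [lap_barrier_of_le hl0 hR.le (not_le.1 hw).le, mul_zero, neg_zero]
    · have := lap_barrier_pos hδ hl.ge (not_lt.1 hzδ) hz
      exact neg_ne_zero.2 (mul_ne_zero hne this.ne')
  rw [integral_neg] at hpos
  linarith

/-- The strong maximum principle for continuous subharmonic functions, in the special case where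
the maximum `c` is attained on a nonempty open set. -/
theorem WeakSubharmonic.eq_of_le {u : ℂ → ℝ} (hu : Continuous u) {G V : Set ℂ} (hG : IsOpen G)
    (hGc : IsPreconnected G) (hsub : ∀ c, WeakSubharmonic G fun z => u z - c) {c : ℝ}
    (hle : ∀ z ∈ G, u z ≤ c) (hV : IsOpen V) (hGV : (G ∩ V).Nonempty) (hc : ∀ z ∈ V, u z = c) :
    ∀ z ∈ G, u z = c := by
  set E := interior {z | u z = c} with hE
  have hEs : ∀ z ∈ E, u z = c := fun z hz => interior_subset (s := {z | u z = c}) hz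
  have hEc : closure E ∩ G ⊆ E := by
    rintro z ⟨hzE, hzG⟩
    obtain ⟨ε, hε, hεG⟩ := Metric.isOpen_iff.1 hG z hzG
    obtain ⟨e, heE, hze⟩ := Metric.mem_closure_iff.1 hzE (ε / 3) (by positivity)
    obtain ⟨δ, hδ, hδE⟩ := Metric.isOpen_iff.1 isOpen_interior e heE
    have hb : closedBall e (ε / 2) ⊆ G := by
      refine Subset.trans (fun w hw => ?_) hεG
      rw [mem_closedBall] at hw
      rw [mem_ball]
      have := dist_triangle w e z
      rw [dist_comm e z] at this
      linarith
    have h := WeakSubharmonic.eq_zero_of_ball (hu.sub continuous_const) hδ ((hsub c).mono hb)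
      (fun w hw => sub_nonpos.2 (hle w (hb (ball_subset_closedBall hw))))
      (fun w hw => sub_eq_zero.2 (hEs w (hδE hw)))
    refine mem_interior.2 ⟨ball e (ε / 2), fun w hw => sub_eq_zero.1 (h w hw), isOpen_ball, ?_⟩
    rw [mem_ball]; linarith
  have hVE : V ⊆ E := interior_maximal hc hV
  have := hGc.subset_of_closure_inter_subset isOpen_interior
    (hGV.mono (inter_subset_inter_right _ hVE)) hEc
  exact fun z hz => hEs z (this hz)

/-! ### Growth in a cone of directions, and convex hulls of finite sets -/

theorem IsTest.integral_fderiv_eq_zero {D : Set ℂ} {g : ℂ → ℝ} (hg : IsTest D g) (v : ℂ) :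
    ∫ z, fderiv ℝ g z v = 0 := by
  have h := (integral_mul_fderiv_of_contDiffOn isOpen_univ (contDiffOn_const (c := (1 : ℝ)))
    (hg.mono (subset_univ _)) v).2.2
  simpa using h

theorem WeakPotential.sub_const {D : Set ℂ} {F : ℂ → ℂ} {u : ℂ → ℝ} (hu : Continuous u)
    (h : WeakPotential D F u) (c : ℝ) : WeakPotential D F fun z => u z - c := by
  intro g hg v
  have hgv := hg.fderiv_apply v
  simp only [sub_mul]
  rw [integral_sub (hgv.integrable_mul hu.locallyIntegrable)
    (hgv.integrable_mul (locallyIntegrable_const c)), integral_const_mul,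
    hg.integral_fderiv_eq_zero, mul_zero, sub_zero, h g hg v]

/-- The open cone with apex `q` spanned by the directions `-v`, `v ∈ ball v₀ η`. -/
def backCone (q v₀ : ℂ) (η : ℝ) : Set ℂ := {w | ∃ t : ℝ, 0 < t ∧ w ∈ ball (q - t * v₀) (t * η)}

theorem isOpen_backCone (q v₀ : ℂ) (η : ℝ) : IsOpen (backCone q v₀ η) := by
  have : backCone q v₀ η = ⋃ t : ℝ, ⋃ _ : 0 < t, ball (q - t * v₀) (t * η) := by
    ext w; simp [backCone]
  rw [this]
  exact isOpen_iUnion fun t => isOpen_iUnion fun _ => isOpen_ball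

theorem convex_backCone (q v₀ : ℂ) (η : ℝ) : Convex ℝ (backCone q v₀ η) := by
  rw [convex_iff_forall_pos]
  rintro x ⟨s, hs, hx⟩ y ⟨t, ht, hy⟩ a b ha hb hab
  refine ⟨a * s + b * t, by positivity, ?_⟩
  rw [mem_ball, dist_eq_norm] at hx hy ⊢
  have e : a • x + b • y - (q - ((a * s + b * t : ℝ) : ℂ) * v₀) =
      a • (x - (q - s * v₀)) + b • (y - (q - t * v₀)) := by
    have : (a : ℂ) + b = 1 := by exact_mod_cast hab
    simp only [Complex.real_smul]
    push_cast
    linear_combination q * this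
  rw [e]
  refine (norm_add_le _ _).trans_lt ?_
  rw [norm_smul, norm_smul, Real.norm_of_nonneg ha.le, Real.norm_of_nonneg hb.le]
  nlinarith [mul_lt_mul_of_pos_left hx ha, mul_lt_mul_of_pos_left hy hb]

/-- Let `u` be a potential of `F` near `p`, where `∂F/∂z̄ ≥ 0`, where `F` vanishes on an open set
`M` adherent to `p`, and where `u` increases in all directions of an open cone. Then near `p` the
minimum of `u` is `u p`, and it is attained at all points of `M`. Indeed, every point `q ∈ M` is an
interior maximum of `u` over the cone of points below it, so that `u` is constant there by the
strong maximum principle, and the cones below all points near `p` overlap. -/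
theorem eventually_le_of_cone {p : ℂ} {R : ℝ} (hR : 0 < R) {F : ℂ → ℂ} {u : ℂ → ℝ}
    (hFl : LocallyIntegrable F) (hu : Continuous u) (hW : WeakPotential (ball p R) F u)
    (hF : DbarNonneg (ball p R) F) {v₀ : ℂ} {η : ℝ} (hη : 0 < η)
    (hcone : ∀ v ∈ ball v₀ η, ∀ᵐ z ∂(volume.restrict (ball p R)), 0 ≤ (F z * v).re)
    {M : Set ℂ} (hMo : IsOpen M) (hMp : p ∈ closure M)
    (hM : ∀ᵐ z ∂(volume.restrict (ball p R)), z ∈ M → F z = 0) :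
    ∀ᶠ z in 𝓝 p, u p ≤ u z ∧ (z ∈ M → u z = u p) := by
  -- monotonicity along the cone
  have mono : ∀ x ∈ ball p R, ∀ y ∈ ball p R, ∀ t : ℝ, 0 < t → ∀ v ∈ ball v₀ η,
      x + t * v = y → u x ≤ u y := by
    rintro x hx y hy t ht v hv rfl
    simpa using hW.add_mul_le isOpen_ball (convex_ball p R) hFl hu (hcone v hv) ht.le hx hy
  set T := R / (2 * (‖v₀‖ + 1)) with hT
  have hT0 : 0 < T := by positivity
  have hTv : T * ‖v₀‖ < R / 2 := by
    rw [hT, div_mul_eq_mul_div, div_lt_div_iff₀ (by positivity) (by positivity)]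
    nlinarith [norm_nonneg v₀]
  set r := min (R / 2) (T * η / 2) with hr
  have hr0 : 0 < r := by positivity
  have hrR : r ≤ R / 2 := min_le_left _ _
  have key : ∀ q ∈ M, q ∈ ball p r → ∀ z ∈ ball p r, u q ≤ u z := by
    intro q hqM hq z hz
    have hqR : q ∈ ball p R := ball_subset_ball (by linarith) hq
    -- `u` is constant near `q`
    obtain ⟨δ, hδ, hδM⟩ := Metric.isOpen_iff.1 (hMo.inter isOpen_ball) q ⟨hqM, hqR⟩
    have hconst : ∀ w ∈ ball q δ, u w = u q := by
      have hsub : ball q δ ⊆ ball p R := hδM.trans inter_subset_right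
      have hF0 : ∀ v : ℂ, ∀ᵐ z ∂(volume.restrict (ball q δ)), 0 ≤ (F z * v).re := by
        intro v
        filter_upwards [ae_restrict_of_ae_restrict_of_subset hsub hM,
          ae_restrict_mem measurableSet_ball] with z h1 h2
        rw [h1 (hδM h2).1]; simp
      have hle : ∀ x ∈ ball q δ, ∀ y ∈ ball q δ, u x ≤ u y := by
        intro x hx y hy
        have := (hW.mono hsub).add_mul_le isOpen_ball (convex_ball q δ) hFl hu (hF0 (y - x))
          zero_le_one hx (by simpa using hy)
        simpa using this
      exact fun w hw => le_antisymm (hle w hw q (mem_ball_self hδ)) (hle q (mem_ball_self hδ) w hw)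
    set G := backCone q v₀ η ∩ ball p R with hG
    have hGo : IsOpen G := (isOpen_backCone _ _ _).inter isOpen_ball
    have hGle : ∀ w ∈ G, u w ≤ u q := by
      rintro w ⟨⟨t, ht, hw⟩, hwR⟩
      have htc : (t : ℂ) ≠ 0 := by exact_mod_cast ht.ne'
      refine mono w hwR q hqR t ht ((q - w) / t) ?_ (by field_simp; ring)
      rw [mem_ball, dist_eq_norm] at hw ⊢
      have e : (q - w) / t - v₀ = -(w - (q - t * v₀)) / t := by field_simp; ring
      rw [e, norm_div, norm_neg, Complex.norm_real, Real.norm_of_nonneg ht.le,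
        div_lt_iff₀ ht, mul_comm η]
      exact hw
    have hGV : (G ∩ ball q δ).Nonempty := by
      set t := δ / (2 * (‖v₀‖ + 1)) with ht
      have ht0 : 0 < t := by positivity
      have hmem : q - t * v₀ ∈ ball q δ := by
        rw [mem_ball, dist_eq_norm, sub_sub_cancel_left, norm_neg, norm_mul, Complex.norm_real,
          Real.norm_of_nonneg ht0.le, ht, div_mul_eq_mul_div, div_lt_iff₀ (by positivity)]
        nlinarith [norm_nonneg v₀]
      exact ⟨q - t * v₀, ⟨⟨t, ht0, mem_ball_self (by positivity)⟩, (hδM hmem).2⟩, hmem⟩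
    have hGc : ∀ w ∈ G, u w = u q :=
      WeakSubharmonic.eq_of_le hu hGo
        ((convex_backCone _ _ _).inter (convex_ball p R)).isPreconnected
        (fun c => ((hW.sub_const hu c).weakSubharmonic hFl (hu.sub continuous_const) hF).mono
          inter_subset_right) hGle isOpen_ball hGV hconst
    rw [mem_ball] at hq hz
    have hzR : z - T * v₀ ∈ ball p R := by
      rw [mem_ball, dist_eq_norm, sub_right_comm]
      refine (norm_sub_le _ _).trans_lt ?_
      rw [← dist_eq_norm, norm_mul, Complex.norm_real, Real.norm_of_nonneg hT0.le]
      linarith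
    have hzG : z - T * v₀ ∈ G := by
      refine ⟨⟨T, hT0, ?_⟩, hzR⟩
      rw [mem_ball, dist_sub_right]
      have h1 := dist_triangle_right z q p
      have h2 : r ≤ T * η / 2 := min_le_right _ _
      linarith
    rw [← hGc _ hzG]
    exact mono _ hzR z (mem_ball.2 (by linarith)) T hT0 v₀ (mem_ball_self hη) (by ring)
  have hle : ∀ z ∈ ball p r, u p ≤ u z := by
    intro z hz
    have hcl : IsClosed {q | u q ≤ u z} := isClosed_le hu continuous_const
    have hsub : M ∩ ball p r ⊆ {q | u q ≤ u z} := fun q hq => key q hq.1 hq.2 z hz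
    have hp : p ∈ closure (M ∩ ball p r) :=
      mem_closure_iff_nhds.2 fun t ht => by
        have := mem_closure_iff_nhds.1 hMp _ (inter_mem ht (ball_mem_nhds p hr0))
        rwa [inter_assoc, inter_comm (ball p r)] at this
    exact closure_minimal hsub hcl hp
  filter_upwards [ball_mem_nhds p hr0] with z hz
  exact ⟨hle z hz, fun hzM => le_antisymm (key z hzM hz p (mem_ball_self hr0)) (hle z hz)⟩

/-- An extreme point of the convex hull of finitely many distinct points is strictly exposed. -/
theorem exists_re_mul_lt_of_mem_extremePoints {ι : Type*} [Finite ι] {a : ι → ℂ}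
    (ha : Function.Injective a) {i : ι}
    (hi : a i ∈ (convexHull ℝ (range a)).extremePoints ℝ) :
    ∃ v : ℂ, ∀ j, j ≠ i → (a i * v).re < (a j * v).re := by
  have h := ((convex_convexHull ℝ (range a)).mem_extremePoints_iff_mem_sdiff_convexHull_sdiff.1
    hi).2
  have hfin : (a '' {j | j ≠ i}).Finite := toFinite _
  have hni : a i ∉ convexHull ℝ (a '' {j | j ≠ i}) := by
    refine fun hmem => h (convexHull_mono ?_ hmem)
    rintro _ ⟨j, hj, rfl⟩
    exact ⟨subset_convexHull ℝ _ (mem_range_self j), fun he => hj (ha he)⟩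
  obtain ⟨f, c, hfc, hcf⟩ := geometric_hahn_banach_point_closed (convex_convexHull ℝ _)
    (hfin.isClosed_convexHull ℝ) hni
  -- represent the real-linear functional `f` as `w ↦ Re (w v)`
  have hf : ∀ w : ℂ, f w = (w * ⟨f 1, -f Complex.I⟩).re := by
    intro w
    have : w = w.re • (1 : ℂ) + w.im • Complex.I := by apply Complex.ext <;> simp
    conv_lhs => rw [this, map_add, map_smul, map_smul]
    simp
  refine ⟨⟨f 1, -f Complex.I⟩, fun j hj => ?_⟩
  rw [← hf, ← hf]
  exact hfc.trans (hcf _ (subset_convexHull ℝ _ (mem_image_of_mem a hj)))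

/-- The support function of a convex hull strictly dominates the linear functional of an interior
point. -/
theorem exists_add_mul_norm_le_of_mem_interior {ι : Type*} {a : ι → ℂ} {b : ℂ}
    (hb : b ∈ interior (convexHull ℝ (range a))) :
    ∃ ε > 0, ∀ v : ℂ, v ≠ 0 → ∃ i, (b * v).re + ε * ‖v‖ ≤ (a i * v).re := by
  obtain ⟨ε, hε, hball⟩ := Metric.isOpen_iff.1 isOpen_interior b hb
  refine ⟨ε / 2, by positivity, fun v hv => ?_⟩
  by_contra! hcon
  have hv' : (‖v‖ : ℂ) ≠ 0 := by exact_mod_cast norm_ne_zero_iff.2 hv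
  set w : ℂ := b + (ε / 2 : ℝ) * (starRingEnd ℂ v / ‖v‖) with hw
  have hwK : w ∈ convexHull ℝ (range a) := by
    refine interior_subset (hball ?_)
    rw [mem_ball, dist_eq_norm, hw, add_sub_cancel_left, norm_mul, norm_div, Complex.norm_conj,
      Complex.norm_real, Complex.norm_real, norm_norm, div_self (norm_ne_zero_iff.2 hv),
      Real.norm_of_nonneg (by positivity)]
    linarith
  have hwv : (w * v).re = (b * v).re + ε / 2 * ‖v‖ := by
    have : w * v = b * v + ((ε / 2 * ‖v‖ : ℝ) : ℂ) := by
      have h1 : starRingEnd ℂ v * v = (‖v‖ : ℂ) ^ 2 := by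
        rw [mul_comm, Complex.mul_conj, Complex.normSq_eq_norm_sq]; push_cast; rfl
      rw [hw, add_mul]
      push_cast
      field_simp
      linear_combination ε * h1
    rw [this, Complex.add_re, Complex.ofReal_re]
  have hhalf : Convex ℝ {x : ℂ | (x * v).re < (w * v).re} := by
    have hlin : IsLinearMap ℝ fun x : ℂ => (x * v).re :=
      ⟨fun x y => by simp [add_mul], fun c x => by simp [mul_assoc]⟩
    exact convex_halfSpace_lt hlin _
  have hsub : convexHull ℝ (range a) ⊆ {x : ℂ | (x * v).re < (w * v).re} := by
    refine convexHull_min ?_ hhalf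
    rintro _ ⟨i, rfl⟩
    exact (hcon i).trans_eq hwv.symm
  have : (w * v).re < (w * v).re := hsub hwK
  exact lt_irrefl _ this

/-! ### The potential as a maximum -/

/-- Off `p`, the radial derivative at `z` of a potential that is maximal at `z` exceeds that of any
potential whose gradient at `p` is an interior point of the convex hull of all gradients. -/
theorem eventually_radial_pos {ι : Type*} [Finite ι] {p : ℂ} {A : ι → ℂ → ℂ} {h : ι → ℂ → ℝ}
    (hA : ∀ i, ContinuousAt (A i) p) (hp : ∀ i, h i p = 0)
    (hd : ∀ i, HasFDerivAt (h i) (reMul (A i p)) p) {k : ι}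
    (hk : A k p ∈ interior (convexHull ℝ (range fun i => A i p))) :
    ∀ᶠ z in 𝓝 p, z ≠ p → ∀ i, (∀ j, h j z ≤ h i z) → 0 < ((A i z - A k z) * (z - p)).re := by
  obtain ⟨ε, hε, hεj⟩ := exists_add_mul_norm_le_of_mem_interior hk
  have h1 : ∀ᶠ z in 𝓝 p, ∀ i, ‖A i z - A i p‖ < ε / 8 := eventually_all.2 fun i => by
    have := (hA i).eventually (ball_mem_nhds (A i p) (show 0 < ε / 8 by positivity))
    simpa [dist_eq_norm] using this
  have h2 : ∀ᶠ z in 𝓝 p, ∀ i, |h i z - (A i p * (z - p)).re| ≤ ε / 8 * ‖z - p‖ :=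
    eventually_all.2 fun i => by
      have := (hd i).isLittleO.def (show 0 < ε / 8 by positivity)
      simpa [hp i] using this
  filter_upwards [h1, h2] with z hz1 hz2 hzp i hi
  obtain ⟨j, hj⟩ := hεj (z - p) (sub_ne_zero.2 hzp)
  have hpos : 0 < ε * ‖z - p‖ := mul_pos hε (norm_pos_iff.2 (sub_ne_zero.2 hzp))
  have e : ∀ l, |((A l z - A l p) * (z - p)).re| ≤ ε / 8 * ‖z - p‖ := fun l =>
    (Complex.abs_re_le_norm _).trans <| by
      rw [norm_mul]; exact mul_le_mul_of_nonneg_right (hz1 l).le (norm_nonneg _)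
  have ei := (abs_le.1 (e i)).1
  have ek := (abs_le.1 (e k)).2
  have hi2 := (abs_le.1 (hz2 i)).2
  have hj2 := (abs_le.1 (hz2 j)).1
  have hij := hi j
  rw [sub_mul, Complex.sub_re] at ei ek ⊢
  linarith

/-- Near `p`, the potential lies above `h i` if `A i p` is an extreme point of the convex hull of
all the values `A j p`, and it coincides with `h i` on `M i`. -/
theorem eventually_le_of_extreme {ι : Type*} [Finite ι] {p : ℂ} {R : ℝ} (hR : 0 < R)
    {A : ι → ℂ → ℂ} {h : ι → ℂ → ℝ} {M : ι → Set ℂ} {F : ℂ → ℂ} {u : ℂ → ℝ}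
    (hA : ∀ i, ContinuousAt (A i) p) (hinj : Function.Injective fun i => A i p)
    (hh : ∀ i, Continuous (h i)) (hp : ∀ i, h i p = 0) (hMo : ∀ i, IsOpen (M i))
    (hMp : ∀ i, p ∈ closure (M i)) (hu : Continuous u) (hup : u p = 0)
    (hFM : ∀ᵐ z ∂(volume.restrict (ball p R)), (∃ i, z ∈ M i) ∧ ∀ i, z ∈ M i → F z = A i z)
    (hl : ∀ i, LocallyIntegrable fun z => F z - A i z)
    (hW : ∀ i, WeakPotential (ball p R) (fun z => F z - A i z) fun z => u z - h i z)
    (hF : ∀ i, DbarNonneg (ball p R) fun z => F z - A i z) {i : ι}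
    (hi : A i p ∈ (convexHull ℝ (range fun i => A i p)).extremePoints ℝ) :
    ∀ᶠ z in 𝓝 p, h i z ≤ u z ∧ (z ∈ M i → u z = h i z) := by
  obtain ⟨v₀, hv₀⟩ := exists_re_mul_lt_of_mem_extremePoints hinj hi
  have hev : ∀ᶠ x : ℂ × ℂ in 𝓝 (p, v₀), ∀ j, j ≠ i →
      0 < ((A j x.1 - A i x.1) * x.2).re := by
    refine eventually_all.2 fun j => ?_
    by_cases hj : j = i
    · exact Eventually.of_forall fun x hx => absurd hj hx
    have hA' : ∀ j, ContinuousAt (fun x : ℂ × ℂ => A j x.1) (p, v₀) := fun j =>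
      ContinuousAt.comp (x := (p, v₀)) (f := Prod.fst) (hA j) continuousAt_fst
    have hc : ContinuousAt (fun x : ℂ × ℂ => ((A j x.1 - A i x.1) * x.2).re) (p, v₀) :=
      Complex.continuous_re.continuousAt.comp (((hA' j).sub (hA' i)).mul continuousAt_snd)
    have h0 : 0 < ((A j p - A i p) * v₀).re := by
      rw [sub_mul, Complex.sub_re]; exact sub_pos.2 (hv₀ j hj)
    filter_upwards [hc.eventually (lt_mem_nhds h0)] with x hx _ using hx
  obtain ⟨η, hη, hball⟩ := Metric.eventually_nhds_iff_ball.1 hev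
  have hsub : ball p (min R η) ⊆ ball p R := ball_subset_ball (min_le_left _ _)
  have hFM' := ae_restrict_of_ae_restrict_of_subset hsub hFM
  have key := eventually_le_of_cone (lt_min hR hη) (hl i) (hu.sub (hh i)) ((hW i).mono hsub)
    ((hF i).mono hsub) hη (v₀ := v₀) (fun v hv => ?_) (hMo i) (hMp i) ?_
  · filter_upwards [key] with z hz
    simp only [Pi.sub_apply, hup, hp, sub_zero] at hz
    exact ⟨sub_nonneg.1 hz.1, fun hzM => sub_eq_zero.1 (hz.2 hzM)⟩
  · filter_upwards [hFM', ae_restrict_mem measurableSet_ball] with z ⟨⟨j, hj⟩, hall⟩ hz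
    by_cases hji : j = i
    · subst hji; simp [hall j hj]
    · rw [hall j hj]
      refine (hball (z, v) ?_ j hji).le
      rw [← ball_prod_same]
      exact ⟨ball_subset_ball (min_le_right _ _) hz, hv⟩
  · filter_upwards [hFM'] with z hz hzM
    rw [hz.2 i hzM, sub_self]

theorem eq_iSup_of_forall_le {ι : Type*} [Finite ι] {f : ι → ℝ} {i : ι} (hi : ∀ j, f j ≤ f i) :
    ⨆ j, f j = f i :=
  haveI : Nonempty ι := ⟨i⟩
  le_antisymm (ciSup_le hi) (le_ciSup (finite_range f).bddAbove i)

/-- The local structure of the potential `u` of a piecewise analytic function `F` with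
`∂F/∂z̄ ≥ 0`: it is the maximum of the potentials `h i` of the analytic pieces `A i`, provided each
`A i p` is either an extreme point or an interior point of the convex hull of all of them. -/
theorem eventually_eq_iSup {ι : Type*} [Finite ι] [Nonempty ι] {p : ℂ} {R : ℝ} (hR : 0 < R)
    {A : ι → ℂ → ℂ} {h : ι → ℂ → ℝ} {M : ι → Set ℂ} {F : ℂ → ℂ} {u : ℂ → ℝ}
    (hA : ∀ i, ContinuousOn (A i) (ball p R)) (hinj : Function.Injective fun i => A i p)
    (hh : ∀ i, Continuous (h i)) (hp : ∀ i, h i p = 0)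
    (hd : ∀ i, HasFDerivAt (h i) (reMul (A i p)) p) (hMo : ∀ i, IsOpen (M i))
    (hMp : ∀ i, p ∈ closure (M i)) (hu : Continuous u) (hup : u p = 0)
    (hFM : ∀ᵐ z ∂(volume.restrict (ball p R)), (∃ i, z ∈ M i) ∧ ∀ i, z ∈ M i → F z = A i z)
    (hl : ∀ i, LocallyIntegrable fun z => F z - A i z)
    (hW : ∀ i, WeakPotential (ball p R) (fun z => F z - A i z) fun z => u z - h i z)
    (hF : ∀ i, DbarNonneg (ball p R) fun z => F z - A i z)
    (hK : ∀ i, A i p ∈ (convexHull ℝ (range fun i => A i p)).extremePoints ℝ ∨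
      A i p ∈ interior (convexHull ℝ (range fun i => A i p))) :
    ∀ᶠ z in 𝓝 p, u z = ⨆ i, h i z := by
  classical
  set K := convexHull ℝ (range fun i => A i p) with hKdef
  have hAat : ∀ i, ∀ z ∈ ball p R, ContinuousAt (A i) z := fun i z hz =>
    (hA i).continuousAt (isOpen_ball.mem_nhds hz)
  have hAp : ∀ i, ContinuousAt (A i) p := fun i => hAat i p (mem_ball_self hR)
  have hext : ∀ᶠ z in 𝓝 p, ∀ i, A i p ∈ K.extremePoints ℝ →
      h i z ≤ u z ∧ (z ∈ M i → u z = h i z) := by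
    refine eventually_all.2 fun i => ?_
    by_cases hi : A i p ∈ K.extremePoints ℝ
    · filter_upwards [eventually_le_of_extreme hR hAp hinj hh hp hMo hMp hu hup hFM hl hW hF hi]
        with z hz _ using hz
    · exact Eventually.of_forall fun z hz => absurd hz hi
  have hrad : ∀ᶠ z in 𝓝 p, ∀ k, A k p ∉ K.extremePoints ℝ → z ≠ p → ∀ i,
      (∀ j, h j z ≤ h i z) → 0 < ((A i z - A k z) * (z - p)).re := by
    refine eventually_all.2 fun k => ?_
    by_cases hk : A k p ∈ K.extremePoints ℝ
    · exact Eventually.of_forall fun z hz => absurd hk hz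
    · filter_upwards [eventually_radial_pos hAp hp hd ((hK k).resolve_left hk)] with z hz _ using hz
  obtain ⟨r₀, hr₀, hr₀ball⟩ := Metric.eventually_nhds_iff_ball.1 (hext.and hrad)
  set r := min r₀ R with hr
  have hr0 : 0 < r := lt_min hr₀ hR
  have hb : ∀ z ∈ ball p r, (∀ i, A i p ∈ K.extremePoints ℝ →
      h i z ≤ u z ∧ (z ∈ M i → u z = h i z)) ∧
      ∀ k, A k p ∉ K.extremePoints ℝ → z ≠ p → ∀ i,
        (∀ j, h j z ≤ h i z) → 0 < ((A i z - A k z) * (z - p)).re :=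
    fun z hz => hr₀ball z (ball_subset_ball (min_le_left _ _) hz)
  have hrR : ball p r ⊆ ball p R := ball_subset_ball (min_le_right _ _)
  have hφ : Continuous fun z => ⨆ i, h i z := by
    cases nonempty_fintype ι
    simp only [← Finset.sup'_univ_eq_ciSup]
    exact Continuous.finset_sup'_apply _ fun i _ => hh i
  -- the upper bound: a positive maximum of `u - ⨆ i, h i` could be increased by moving towards `p`
  have hupper : ∀ z ∈ closedBall p (r / 2), u z ≤ ⨆ i, h i z := by
    obtain ⟨z₀, hz₀, hmax⟩ := (isCompact_closedBall p (r / 2)).exists_isMaxOn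
      ⟨p, mem_closedBall_self (by positivity)⟩ (hu.sub hφ).continuousOn
    suffices hle : u z₀ - ⨆ i, h i z₀ ≤ 0 from fun z hz => sub_nonpos.1 ((hmax hz).trans hle)
    by_contra! hpos
    have hz₀r : z₀ ∈ ball p r := closedBall_subset_ball (by linarith) hz₀
    have hz₀p : z₀ ≠ p := by
      rintro rfl
      simp [hp, hup] at hpos
    obtain ⟨c, hc⟩ : ∃ c : ℝ, 0 < c ∧ ∀ i k, (∀ j, h j z₀ ≤ h i z₀) →
        A k p ∉ K.extremePoints ℝ → c < ((A i z₀ - A k z₀) * (z₀ - p)).re := by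
      have : ∀ᶠ c : ℝ in 𝓝[>] 0, ∀ i k, (∀ j, h j z₀ ≤ h i z₀) →
          A k p ∉ K.extremePoints ℝ → c < ((A i z₀ - A k z₀) * (z₀ - p)).re := by
        refine eventually_all.2 fun i => eventually_all.2 fun k => ?_
        by_cases hik : (∀ j, h j z₀ ≤ h i z₀) ∧ A k p ∉ K.extremePoints ℝ
        · filter_upwards [mem_nhdsWithin_of_mem_nhds
            (gt_mem_nhds ((hb z₀ hz₀r).2 k hik.2 hz₀p i hik.1))] with c hc _ _ using hc
        · exact Eventually.of_forall fun c h1 h2 => absurd ⟨h1, h2⟩ hik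
      exact (eventually_mem_nhdsWithin.and this).exists
    have hnear : ∀ᶠ w in 𝓝 z₀, (w ∈ ball p r ∧ 0 < u w - ⨆ i, h i w) ∧
        (∀ i, (∀ j, h j w ≤ h i w) → ∀ j, h j z₀ ≤ h i z₀) ∧
        ∀ i k, (∀ j, h j z₀ ≤ h i z₀) →
          A k p ∉ K.extremePoints ℝ → c < ((A i w - A k w) * (z₀ - p)).re := by
      refine Eventually.and (Eventually.and (isOpen_ball.mem_nhds hz₀r)
        ((hu.sub hφ).continuousAt.eventually (lt_mem_nhds hpos))) (Eventually.and ?_ ?_)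
      · refine eventually_all.2 fun i => ?_
        by_cases hi : ∀ j, h j z₀ ≤ h i z₀
        · exact Eventually.of_forall fun _ _ => hi
        · push Not at hi
          obtain ⟨j, hj⟩ := hi
          filter_upwards [(hh i).continuousAt.eventually_lt (hh j).continuousAt hj] with w hw hall
          exact absurd (hall j) (not_le.2 hw)
      · refine eventually_all.2 fun i => eventually_all.2 fun k => ?_
        by_cases hik : (∀ j, h j z₀ ≤ h i z₀) ∧ A k p ∉ K.extremePoints ℝ
        · have hcont : ContinuousAt (fun w => ((A i w - A k w) * (z₀ - p)).re) z₀ :=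
            Complex.continuous_re.continuousAt.comp
              (((hAat i z₀ (hrR hz₀r)).sub (hAat k z₀ (hrR hz₀r))).mul continuousAt_const)
          filter_upwards [hcont.eventually (lt_mem_nhds (hc.2 i k hik.1 hik.2))] with w hw _ _
          exact hw
        · exact Eventually.of_forall fun c h1 h2 => absurd ⟨h1, h2⟩ hik
    obtain ⟨δ, hδ, hδball⟩ := Metric.eventually_nhds_iff_ball.1 hnear
    -- a point `z₁` slightly closer to `p` than `z₀`
    obtain ⟨t, ⟨ht0, ht1⟩, htδ⟩ : ∃ t : ℝ, t ∈ Ioo (0 : ℝ) 1 ∧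
        z₀ + t * (p - z₀) ∈ ball z₀ δ := by
      have hcont : ContinuousAt (fun t : ℝ => z₀ + t * (p - z₀)) 0 := by fun_prop
      have h1 : ∀ᶠ t : ℝ in 𝓝[>] 0, z₀ + t * (p - z₀) ∈ ball z₀ δ :=
        mem_nhdsWithin_of_mem_nhds (hcont (by simpa using ball_mem_nhds z₀ hδ))
      exact (Eventually.and (Ioo_mem_nhdsGT zero_lt_one) h1).exists
    set z₁ := z₀ + t * (p - z₀) with hz₁
    obtain ⟨i, hi⟩ := Finite.exists_max fun i => h i z₁
    have hi₀ := (hδball z₁ htδ).2.1 i hi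
    have hsub : ball z₀ δ ⊆ ball p R := fun w hw => hrR (hδball w hw).1.1
    have hgrow := ((hW i).mono hsub).add_mul_le isOpen_ball (convex_ball z₀ δ) (hl i)
      (hu.sub (hh i)) (v := p - z₀) (c := c) ?_ ht0.le (mem_ball_self hδ) htδ
    · have hz₁mem : z₁ ∈ closedBall p (r / 2) := by
        refine (convex_closedBall p (r / 2)).segment_subset hz₀
          (mem_closedBall_self (by positivity)) ?_
        rw [segment_eq_image']
        exact ⟨t, ⟨ht0.le, ht1.le⟩, by simp [hz₁]⟩
      have h1 : u z₁ - ⨆ i, h i z₁ ≤ u z₀ - ⨆ i, h i z₀ := hmax hz₁mem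
      rw [eq_iSup_of_forall_le hi, eq_iSup_of_forall_le hi₀] at h1
      have h2 := mul_pos hc.1 ht0
      simp only [← hz₁, Pi.sub_apply] at hgrow
      linarith
    · filter_upwards [ae_restrict_of_ae_restrict_of_subset hsub hFM,
        ae_restrict_mem measurableSet_ball] with w ⟨⟨k, hk⟩, hall⟩ hw
      obtain ⟨⟨hwr, hwpos⟩, -, hwc⟩ := hδball w hw
      have hkn : A k p ∉ K.extremePoints ℝ := by
        intro hke
        rw [((hb w hwr).1 k hke).2 hk] at hwpos
        have := le_ciSup (finite_range fun i => h i w).bddAbove k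
        linarith
      have h3 := hwc i k hi₀ hkn
      rw [hall k hk]
      have e : (A k w - A i w) * (p - z₀) = (A i w - A k w) * (z₀ - p) := by ring
      rw [e]
      exact h3.le
  filter_upwards [closedBall_mem_nhds p (show 0 < r / 2 by positivity)] with z hz
  refine le_antisymm (hupper z hz) ?_
  -- the lower bound: off `p`, only potentials of extreme pieces can be maximal
  by_cases hzp : z = p
  · subst hzp; simp [hp, hup]
  obtain ⟨i, hi⟩ := Finite.exists_max fun i => h i z
  rw [eq_iSup_of_forall_le hi]
  have hzr : z ∈ ball p r := closedBall_subset_ball (by linarith) hz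
  by_cases hie : A i p ∈ K.extremePoints ℝ
  · exact ((hb z hzr).1 i hie).1
  · have := (hb z hzr).2 i hie hzp i hi
    simp at this

/-! ### Distributions given by functions, and analytic pieces -/

section Distributions

variable {U : Opens ℂ} {f : ℂ → ℂ}

theorem ofFun_apply (hf : LocallyIntegrableOn f (U : Set ℂ)) (ψ : 𝓓(U, ℝ)) :
    ofFun U f ψ = ∫ z, ψ z • f z :=
  TestFunction.integralAgainstBilinCLM_eq_integral (φ := f)
    (B := (ContinuousLinearMap.lsmul ℝ ℝ : ℝ →L[ℝ] ℂ →L[ℝ] ℂ)) hf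

theorem lineDeriv_testFunction_apply (ψ : 𝓓(U, ℝ)) (v z : ℂ) :
    (∂_{v} ψ : 𝓓(U, ℝ)) z = fderiv ℝ ψ z v := by
  rw [TestFunction.lineDerivOp_eq_lineDerivCLM ℝ, TestFunction.lineDerivCLM_apply_of_le (by simp)]
  exact (ψ.contDiff.differentiable (by simp) z).lineDeriv_eq_fderiv

theorem lineDeriv_ofFun_apply (hf : LocallyIntegrableOn f (U : Set ℂ)) (v : ℂ) (ψ : 𝓓(U, ℝ)) :
    (∂_{v} (ofFun U f) : 𝓓'(U, ℂ)) ψ = -∫ z, fderiv ℝ ψ z v • f z := by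
  rw [Distribution.lineDerivOp_apply_apply, map_neg, ofFun_apply hf]
  simp only [lineDeriv_testFunction_apply]

theorem isTest_testFunction (ψ : 𝓓(U, ℝ)) : IsTest U ψ :=
  ⟨ψ.contDiff, ψ.hasCompactSupport, ψ.tsupport_subset⟩

theorem IsTest.integrable_smul {g : ℂ → ℝ} (hg : IsTest U g)
    (hf : LocallyIntegrableOn f (U : Set ℂ)) : Integrable fun z => g z • f z := by
  have h1 : IntegrableOn f (tsupport g) :=
    hf.integrableOn_compact_subset hg.tsupport_subset hg.hasCompactSupport
  have h2 : IntegrableOn (fun z => g z • f z) (tsupport g) :=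
    h1.continuousOn_smul hg.continuous.continuousOn hg.hasCompactSupport
  refine (integrableOn_iff_integrable_of_support_subset fun z hz => ?_).1 h2
  exact subset_tsupport g fun h => hz (by simp [h])

theorem dzbar_ofFun_apply (hf : LocallyIntegrableOn f (U : Set ℂ)) (ψ : 𝓓(U, ℝ)) :
    dzbar (ofFun U f) ψ = -(1 / 2 : ℂ) * ∫ z, f z * twoDbar ψ z := by
  have e : dzbar (ofFun U f) ψ = (1 / 2 : ℂ) • ((∂_{(1 : ℂ)} (ofFun U f) : 𝓓'(U, ℂ)) ψ +
      Complex.I • (∂_{Complex.I} (ofFun U f) : 𝓓'(U, ℂ)) ψ) := rfl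
  have hi := fun v : ℂ => ((isTest_testFunction ψ).fderiv_apply v).integrable_smul hf
  rw [e, lineDeriv_ofFun_apply hf, lineDeriv_ofFun_apply hf, smul_neg, ← neg_add, smul_eq_mul,
    smul_eq_mul, ← integral_const_mul, ← integral_add (hi 1) ((hi _).const_mul _), mul_neg, neg_mul]
  congr 3
  ext z
  simp only [twoDbar, Complex.real_smul]
  ring

theorem dz_ofFun_apply (hf : LocallyIntegrableOn f (U : Set ℂ)) (ψ : 𝓓(U, ℝ)) :
    dz (ofFun U f) ψ = (1 / 2 : ℂ) * (-(∫ z, fderiv ℝ ψ z 1 • f z) +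
      Complex.I * ∫ z, fderiv ℝ ψ z Complex.I • f z) := by
  have e : dz (ofFun U f) ψ = (1 / 2 : ℂ) • ((∂_{(1 : ℂ)} (ofFun U f) : 𝓓'(U, ℂ)) ψ -
      Complex.I • (∂_{Complex.I} (ofFun U f) : 𝓓'(U, ℂ)) ψ) := rfl
  rw [e, lineDeriv_ofFun_apply hf, lineDeriv_ofFun_apply hf, smul_eq_mul, smul_eq_mul]
  ring

theorem twoDbar_eq_zero {D : Set ℂ} {g : ℂ → ℝ} (hg : IsTest D g) {z : ℂ} (hz : z ∉ D) :
    twoDbar g z = 0 := by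
  have : ∀ v, fderiv ℝ g z v = 0 := fun v =>
    image_eq_zero_of_notMem_tsupport (f := fun z => fderiv ℝ g z v)
      fun h => hz ((hg.fderiv_apply v).tsupport_subset h)
  simp [twoDbar, this]

/-- A distribution in `SigmaClass U` that is given by a function has nonnegative `z̄`-derivative in
the sense of testing against functions supported in a subset. -/
theorem dbarNonneg_of_mem_sigmaClass (hf : LocallyIntegrableOn f (U : Set ℂ))
    (h : ofFun U f ∈ SigmaClass U) {D : Set ℂ} (hD : D ⊆ U) (hDm : MeasurableSet D) {F : ℂ → ℂ}
    (hF : ∀ᵐ z ∂(volume.restrict D), f z = F z) : DbarNonneg D F := by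
  have key : ∀ g, IsTest D g → (∀ z, 0 ≤ g z) →
      (∫ z, F z * twoDbar g z).re ≤ 0 ∧ (∫ z, F z * twoDbar g z).im = 0 ∧
      Integrable fun z => F z * twoDbar g z := by
    intro g hg h0
    have hgU := hg.mono hD
    let ψ : 𝓓(U, ℝ) := ⟨g, hg.contDiff, hg.hasCompactSupport, hgU.tsupport_subset⟩
    have hψ := h ψ h0
    rw [dzbar_ofFun_apply hf] at hψ
    have hae : (fun z => f z * twoDbar g z) =ᵐ[volume] fun z => F z * twoDbar g z := by
      filter_upwards [(ae_restrict_iff' hDm).1 hF] with z hz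
      by_cases hzD : z ∈ D
      · rw [hz hzD]
      · simp [twoDbar_eq_zero hg hzD]
    have hint : Integrable fun z => f z * twoDbar g z := by
      have hi := fun v : ℂ => (hgU.fderiv_apply v).integrable_smul hf
      refine ((hi 1).add ((hi Complex.I).const_mul Complex.I)).congr (ae_of_all _ fun z => ?_)
      simp only [twoDbar, Complex.real_smul, Pi.add_apply]
      ring
    have e : ∫ z, f z * twoDbar ψ z = ∫ z, F z * twoDbar g z := integral_congr_ae hae
    have e2 : -(1 / 2 : ℂ) = ((-(1 / 2) : ℝ) : ℂ) := by push_cast; rfl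
    rw [e, e2, Complex.re_ofReal_mul, Complex.im_ofReal_mul] at hψ
    exact ⟨by linarith [hψ.1], by linarith [hψ.2], hint.congr hae⟩
  refine ⟨fun g hg h0 => ?_, fun g hg h0 => ?_⟩
  · obtain ⟨h1, -, hi⟩ := key g hg h0
    have := Complex.reCLM.integral_comp_comm hi
    simp only [Complex.reCLM_apply] at this
    rwa [this]
  · obtain ⟨-, h2, hi⟩ := key g hg h0
    have := Complex.imCLM.integral_comp_comm hi
    simp only [Complex.imCLM_apply] at this
    rwa [this]

end Distributions

/-- An analytic function satisfies the Cauchy–Riemann equation in the weak sense. -/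
theorem integral_mul_twoDbar_eq_zero {D : Set ℂ} (hD : IsOpen D) {A : ℂ → ℂ}
    (hA : AnalyticOnNhd ℂ A D) {g : ℂ → ℝ} (hg : IsTest D g) :
    (Integrable fun z => (A z * twoDbar g z).re) ∧ (Integrable fun z => (A z * twoDbar g z).im) ∧
      ∫ z, (A z * twoDbar g z).re = 0 ∧ ∫ z, (A z * twoDbar g z).im = 0 := by
  have hc : ContDiffOn ℝ 1 A D := (hA.contDiffOn hD.uniqueDiffOn).restrict_scalars ℝ
  have hre : ContDiffOn ℝ 1 (fun z => (A z).re) D := Complex.reCLM.contDiff.comp_contDiffOn hc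
  have him : ContDiffOn ℝ 1 (fun z => (A z).im) D := Complex.imCLM.contDiff.comp_contDiffOn hc
  obtain ⟨i1, j1, e1⟩ := integral_mul_fderiv_of_contDiffOn hD hre hg 1
  obtain ⟨i2, j2, e2⟩ := integral_mul_fderiv_of_contDiffOn hD hre hg Complex.I
  obtain ⟨i3, j3, e3⟩ := integral_mul_fderiv_of_contDiffOn hD him hg 1
  obtain ⟨i4, j4, e4⟩ := integral_mul_fderiv_of_contDiffOn hD him hg Complex.I
  have h1 : (fun z => (A z * twoDbar g z).re) = fun z =>
      (A z).re * fderiv ℝ g z 1 - (A z).im * fderiv ℝ g z Complex.I := by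
    ext z; simp [twoDbar]
  have h2 : (fun z => (A z * twoDbar g z).im) = fun z =>
      (A z).re * fderiv ℝ g z Complex.I + (A z).im * fderiv ℝ g z 1 := by
    ext z; simp [twoDbar]
  have hd : ∀ z ∈ D, ∀ v, fderiv ℝ (fun z => (A z).re) z v = (deriv A z * v).re ∧
      fderiv ℝ (fun z => (A z).im) z v = (deriv A z * v).im := by
    intro z hz v
    have h := (hA z hz).differentiableAt.hasDerivAt.hasFDerivAt.restrictScalars ℝ
    have hr := (Complex.reCLM.hasFDerivAt.comp z h).fderiv
    have hi := (Complex.imCLM.hasFDerivAt.comp z h).fderiv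
    change fderiv ℝ (fun z => (A z).re) z = _ at hr
    change fderiv ℝ (fun z => (A z).im) z = _ at hi
    rw [hr, hi]
    simp [mul_comm]
  have hg0 : ∀ z, z ∉ D → g z = 0 := fun z hz =>
    image_eq_zero_of_notMem_tsupport fun h => hz (hg.tsupport_subset h)
  rw [h1, h2]
  refine ⟨i1.sub i4, i2.add i3, ?_, ?_⟩
  · rw [integral_sub i1 i4, e1, e4, sub_eq_zero, neg_inj]
    congr 1; ext z
    by_cases hz : z ∈ D
    · rw [(hd z hz 1).1, (hd z hz _).2]; simp
    · simp [hg0 z hz]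
  · rw [integral_add i2 i3, e2, e3, ← neg_add, ← integral_add j2 j3, neg_eq_zero]
    refine integral_eq_zero_of_ae (ae_of_all _ fun z => ?_)
    by_cases hz : z ∈ D
    · simp only [(hd z hz _).1, (hd z hz 1).2]; simp
    · simp [hg0 z hz]

/-- Subtracting an analytic function does not change `∂F/∂z̄`. -/
theorem DbarNonneg.sub_analytic {D : Set ℂ} (hD : IsOpen D) {F A a : ℂ → ℂ}
    (hF : DbarNonneg D F) (hFl : LocallyIntegrable F) (hA : AnalyticOnNhd ℂ A D)
    (ha : EqOn a A D) : DbarNonneg D fun z => F z - a z := by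
  have hi : ∀ g, IsTest D g → Integrable fun z => F z * twoDbar g z := by
    intro g hg
    have hi := fun v : ℂ => hFl.integrable_smul_left_of_hasCompactSupport
      (hg.fderiv_apply v).continuous (hg.fderiv_apply v).hasCompactSupport
    refine ((hi 1).add ((hi Complex.I).const_mul Complex.I)).congr (ae_of_all _ fun z => ?_)
    simp only [twoDbar, Complex.real_smul, Pi.add_apply]
    ring
  have e : ∀ g, IsTest D g → ∀ z, (F z - a z) * twoDbar g z =
      F z * twoDbar g z - A z * twoDbar g z := by
    intro g hg z
    by_cases hz : z ∈ D
    · rw [ha hz, sub_mul]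
    · simp [twoDbar_eq_zero hg hz]
  refine ⟨fun g hg h0 => ?_, fun g hg h0 => ?_⟩ <;>
    obtain ⟨i1, i2, e1, e2⟩ := integral_mul_twoDbar_eq_zero hD hA hg
  · simp only [e g hg, Complex.sub_re]
    have hre : Integrable fun z => (F z * twoDbar g z).re := (hi g hg).re
    rw [integral_sub hre i1, e1, sub_zero]
    exact hF.1 g hg h0
  · simp only [e g hg, Complex.sub_im]
    have him : Integrable fun z => (F z * twoDbar g z).im := (hi g hg).im
    rw [integral_sub him i2, e2, sub_zero]
    exact hF.2 g hg h0

theorem WeakPotential.sub_of_hasFDerivAt {D : Set ℂ} (hD : IsOpen D) {F a : ℂ → ℂ} {u h : ℂ → ℝ}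
    (hW : WeakPotential D F u) (hu : Continuous u) (hFl : LocallyIntegrable F)
    (ha : ContinuousOn a D) (hh : ∀ z ∈ D, HasFDerivAt h (reMul (a z)) z) :
    WeakPotential D (fun z => F z - a z) fun z => u z - h z := by
  intro g hg v
  have hcd : ContDiffOn ℝ 1 h D := by
    refine (contDiffOn_succ_iff_fderiv_of_isOpen (n := 0) hD).2
      ⟨fun x hx => (hh x hx).differentiableAt.differentiableWithinAt, by simp, ?_⟩
    refine contDiffOn_zero.2 ?_
    exact (reMul.continuous.comp_continuousOn ha).congr fun x hx => (hh x hx).fderiv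
  obtain ⟨i1, i2, e⟩ := integral_mul_fderiv_of_contDiffOn hD hcd hg v
  have e' : (fun z => fderiv ℝ h z v * g z) = fun z => (a z * v).re * g z := by
    ext z
    by_cases hz : z ∈ D
    · rw [(hh z hz).fderiv, reMul_apply]
    · rw [image_eq_zero_of_notMem_tsupport fun h => hz (hg.tsupport_subset h), mul_zero, mul_zero]
  rw [e'] at i2 e
  simp only [sub_mul, Complex.sub_re]
  rw [integral_sub ((hg.fderiv_apply v).integrable_mul hu.locallyIntegrable) i1,
    integral_sub (hg.integrable_mul (locallyIntegrable_re_mul hFl v)) i2, hW g hg v, e]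
  ring

theorem potential_self (U : Set ℂ) (A : ℂ → ℂ) {p : ℂ} (hp : p ∈ U) : potential U A p p = 0 := by
  have : segment ℝ p p ⊆ U := by simpa using hp
  rw [potential, pathIntegral, if_pos this]
  simp

/-- In a disc about `p` contained in `U`, the potential of `A` has gradient `conj A`. -/
theorem hasFDerivAt_potential {U : Set ℂ} {A : ℂ → ℂ} {p : ℂ} {R : ℝ} (hU : ball p R ⊆ U)
    (hA : AnalyticOnNhd ℂ A (ball p R)) {z : ℂ} (hz : z ∈ ball p R) :
    HasFDerivAt (potential U A p) (reMul (A z)) z := by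
  have hR : 0 < R := dist_nonneg.trans_lt hz
  have hform : ∀ w, oneForm A w = ContinuousLinearMap.smulRightL ℂ ℂ ℂ 1 (A w) := by
    intro w; ext; simp [oneForm]
  have h1 : HasFDerivWithinAt (fun x => curveIntegral (oneForm A) (Path.segment p x))
      (oneForm A z) (ball p R) z := by
    refine (convex_ball p R).hasFDerivWithinAt_curveIntegral_segment_of_hasFDerivWithinAt_symmetric
      (dω := fun x => ((ContinuousLinearMap.toSpanSingleton ℂ
        (ContinuousLinearMap.smulRightL ℂ ℂ ℂ 1 (deriv A x))).restrictScalars ℝ))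
      ?_ ?_ (mem_ball_self hR) hz
    · intro x hx
      have hd := (hA x hx).differentiableAt.hasDerivAt
      have := ((ContinuousLinearMap.smulRightL ℂ ℂ ℂ 1).hasFDerivAt (x := A x)).comp_hasDerivAt x hd
      have e : oneForm A = ⇑(ContinuousLinearMap.smulRightL ℂ ℂ ℂ 1) ∘ A := funext hform
      rw [e]
      exact (this.hasFDerivAt.restrictScalars ℝ).hasFDerivWithinAt
    · intro x _ a _ b _
      simp [mul_left_comm]
  have h2 := ((h1.hasFDerivAt (isOpen_ball.mem_nhds hz)).restrictScalars ℝ)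
  have h3 := Complex.reCLM.hasFDerivAt.comp z h2
  have e : Complex.reCLM.comp ((oneForm A z).restrictScalars ℝ) = reMul (A z) := by
    ext v
    simp [oneForm, mul_comm]
  rw [e] at h3
  refine h3.congr_of_eventuallyEq ?_
  filter_upwards [isOpen_ball.mem_nhds hz] with w hw
  have hseg : segment ℝ p w ⊆ U :=
    ((convex_ball p R).segment_subset (mem_ball_self hR) hw).trans hU
  simp [potential, pathIntegral, hseg]

/-- A function that is continuous on a disc agrees on a smaller disc with a function continuous on
the plane. -/
theorem exists_continuous_eqOn_ball {f : ℂ → ℝ} {p : ℂ} {R R' : ℝ} (hR' : 0 < R') (hR : R' < R)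
    (hf : ContinuousOn f (ball p R)) : ∃ h : ℂ → ℝ, Continuous h ∧ EqOn h f (ball p R') := by
  let χ : ContDiffBump p := ⟨R', (R' + R) / 2, hR', by linarith⟩
  refine ⟨fun z => χ z * f z, continuous_of_tsupport fun x hx => ?_, fun z hz => ?_⟩
  · have hx' : x ∈ closedBall p ((R' + R) / 2) := by
      have := tsupport_mul_subset_left hx
      rwa [χ.tsupport_eq] at this
    have hxR : x ∈ ball p R := closedBall_subset_ball (by linarith) hx'
    exact χ.continuous.continuousAt.mul (hf.continuousAt (isOpen_ball.mem_nhds hxR))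
  · simp only
    rw [χ.one_of_mem_closedBall (ball_subset_closedBall hz), one_mul]

/-! ### Piecewise analytic functions -/

/-- A weak potential with `f = F` almost everywhere satisfies `f = 2 ∂u/∂z` as distributions. -/
theorem eqTwoDz_of_weakPotential {N : Opens ℂ} {f F : ℂ → ℂ} {u φ : ℂ → ℝ}
    (hf : LocallyIntegrableOn f (N : Set ℂ)) (hfF : ∀ᵐ z ∂(volume.restrict (N : Set ℂ)), f z = F z)
    (hu : Continuous u) (hW : WeakPotential N F u) (hφ : ∀ z ∈ N, φ z = u z) :
    EqTwoDz N f φ := by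
  have hφc : ContinuousOn φ (N : Set ℂ) := hu.continuousOn.congr hφ
  have hφC : LocallyIntegrableOn (fun z => (φ z : ℂ)) (N : Set ℂ) :=
    (Complex.continuous_ofReal.comp_continuousOn hφc).locallyIntegrableOn N.isOpen.measurableSet
  have hg : LocallyIntegrableOn (fun z => (1 / 2 : ℂ) * f z) (N : Set ℂ) := hf.smul (1 / 2 : ℂ)
  refine ⟨hφc.locallyIntegrableOn N.isOpen.measurableSet, fun z => 1 / 2 * f z, hg, ?_,
    ae_of_all _ fun z => by ring⟩
  ext ψ
  rw [ofFun_apply hg, dz_ofFun_apply hφC]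
  have ht := isTest_testFunction ψ
  have hψ0 : ∀ z, z ∉ (N : Set ℂ) → ψ z = 0 := fun z hz =>
    image_eq_zero_of_notMem_tsupport fun h => hz (ht.tsupport_subset h)
  have hi : Integrable fun z => ψ z • f z := ht.integrable_smul hf
  have hae : ∀ v : ℂ, ∫ z, (F z * v).re * ψ z = (∫ z, ψ z • f z * v).re := by
    intro v
    have := Complex.reCLM.integral_comp_comm (hi.mul_const v)
    simp only [Complex.reCLM_apply] at this
    rw [← this]
    refine integral_congr_ae ?_
    filter_upwards [(ae_restrict_iff' N.isOpen.measurableSet).1 hfF] with z hz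
    by_cases hzN : z ∈ (N : Set ℂ)
    · simp only [← hz hzN]
      rw [smul_mul_assoc, Complex.smul_re, smul_eq_mul, mul_comm]
    · simp [hψ0 z hzN]
  have hd : ∀ v : ℂ, ∫ z, fderiv ℝ ψ z v • (φ z : ℂ) = ((-(∫ z, ψ z • f z * v).re : ℝ) : ℂ) := by
    intro v
    rw [← hae v, ← hW ψ ht v, ← integral_complex_ofReal]
    congr 1; ext z
    by_cases hzN : z ∈ (N : Set ℂ)
    · rw [hφ z hzN, Complex.real_smul]; push_cast; ring
    · have : fderiv ℝ ψ z v = 0 :=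
        image_eq_zero_of_notMem_tsupport (f := fun z => fderiv ℝ ψ z v)
          fun h => hzN ((ht.fderiv_apply v).tsupport_subset h)
      simp [this]
  have hl : ∫ z, ψ z • (1 / 2 * f z) = 1 / 2 * ∫ z, ψ z • f z := by
    rw [← integral_const_mul]
    congr 1; ext z
    simp only [Complex.real_smul]; ring
  rw [hd, hd, hl, integral_mul_const, integral_mul_const]
  congr 1
  apply Complex.ext <;> simp

variable {U : Opens ℂ} {r : ℕ} {M : Fin r → Set ℂ} {A : Fin r → ℂ → ℂ} {Φ : ℂ → ℂ}

theorem IsPiecewiseAnalytic.sum_indicator_eq (hΦ : IsPiecewiseAnalytic U M A Φ)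
    (B : Fin r → ℂ → ℂ) {i : Fin r} {z : ℂ} (hz : z ∈ M i) :
    ∑ j, (M j).indicator (B j) z = B i z := by
  rw [Finset.sum_eq_single i]
  · exact indicator_of_mem hz _
  · intro j _ hj
    exact indicator_of_notMem (fun hj' => (hΦ.disjoint j i hj).le_bot ⟨hj', hz⟩) _
  · simp

theorem IsPiecewiseAnalytic.locallyIntegrableOn (hΦ : IsPiecewiseAnalytic U M A Φ) :
    LocallyIntegrableOn Φ (U : Set ℂ) := by
  rw [locallyIntegrableOn_iff U.isOpen.isLocallyClosed]
  intro k hk hkc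
  have h : IntegrableOn (fun z => ∑ i, (M i).indicator (A i) z) k :=
    integrable_finsetSum _ fun i _ =>
      (((hΦ.analytic i).continuousOn.mono hk).integrableOn_compact hkc).indicator
        (hΦ.isOpen i).measurableSet
  refine h.congr ?_
  filter_upwards [ae_restrict_of_ae_restrict_of_subset hk hΦ.ae_eq] with z hz using hz.symm

theorem IsPiecewiseAnalytic.ae_exists_mem (hΦ : IsPiecewiseAnalytic U M A Φ) :
    ∀ᵐ z ∂(volume.restrict (U : Set ℂ)), ∃ i, z ∈ M i := by
  rw [ae_restrict_iff' U.isOpen.measurableSet]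
  filter_upwards [measure_eq_zero_iff_ae_notMem.1 hΦ.null] with z hz hzU
  by_contra hcon
  exact hz ⟨hzU, by simpa using hcon⟩

theorem eventually_notMem_of_notMem_activeSet (M : Fin r → Set ℂ) (p : ℂ) :
    ∀ᶠ z in 𝓝 p, ∀ i, i ∉ activeSet M p → z ∉ M i := by
  refine eventually_all.2 fun i => ?_
  by_cases hi : i ∈ activeSet M p
  · exact Eventually.of_forall fun z h => absurd hi h
  · have : (closure (M i))ᶜ ∈ 𝓝 p := isClosed_closure.isOpen_compl.mem_nhds hi
    filter_upwards [this] with z hz _ hzM using hz (subset_closure hzM)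

end PiecewiseAnalytic

theorem corollary2 (U : TopologicalSpace.Opens ℂ) (hU : IsSimplyConnected (U : Set ℂ))
    (r : ℕ) (M : Fin r → Set ℂ) (A : Fin r → ℂ → ℂ) (Φ : ℂ → ℂ)
    (hΦ : PiecewiseAnalytic.IsPiecewiseAnalytic U M A Φ)
    (hpos : PiecewiseAnalytic.ofFun U Φ ∈ PiecewiseAnalytic.SigmaClass U)
    (p : ℂ) (hp : p ∈ U)
    (hne : ∀ i k : Fin r, i ≠ k → A i p ≠ A k p)
    (hK : ∀ k ∈ PiecewiseAnalytic.activeSet M p \ PiecewiseAnalytic.extremeSet M A p,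
      A k p ∉ frontier (PiecewiseAnalytic.hull M A p)) :
    ∃ N : TopologicalSpace.Opens ℂ, p ∈ N ∧ N ≤ U ∧
      PiecewiseAnalytic.EqTwoDz N Φ (PiecewiseAnalytic.maxPotential U M A p) := by
  open PiecewiseAnalytic Metric Filter Topology in
  -- `Φ` is cut off outside the disc of radius `R`; its potential lives on the disc of radius `R₂`,
  -- half as large; the conclusion holds on a disc of radius at most `R₂`
  obtain ⟨R₀, hR₀, hR₀U⟩ := Metric.eventually_nhds_iff_ball.1
    (Eventually.and (U.isOpen.mem_nhds hp) (eventually_notMem_of_notMem_activeSet M p))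
  set R := R₀ / 2 with hR
  have hR0 : 0 < R := by positivity
  have hcb : closedBall p R ⊆ (U : Set ℂ) := fun z hz =>
    (hR₀U z (closedBall_subset_ball (by linarith) hz)).1
  have hbU : ball p R ⊆ (U : Set ℂ) := ball_subset_closedBall.trans hcb
  have hact : ∀ z ∈ ball p R, ∀ i, z ∈ M i → i ∈ activeSet M p := fun z hz i hzi => by
    by_contra hi
    exact (hR₀U z (ball_subset_ball (by linarith) hz)).2 i hi hzi
  have haeb : ∀ᵐ z ∂(volume.restrict (ball p R)), (∃ i, z ∈ M i) ∧
      Φ z = ∑ i, (M i).indicator (A i) z :=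
    ae_restrict_of_ae_restrict_of_subset hbU (hΦ.ae_exists_mem.and hΦ.ae_eq)
  -- cutting off makes the pieces bounded and measurable on the whole plane
  let a : Fin r → ℂ → ℂ := fun i => (ball p R).indicator (A i)
  let F : ℂ → ℂ := fun z => ∑ i, (M i).indicator (a i) z
  have haA : ∀ i, EqOn (a i) (A i) (ball p R) := fun i z hz => indicator_of_mem hz _
  have ham : ∀ i, Measurable (a i) := fun i => by
    classical
    have := ((hΦ.analytic i).continuousOn.mono hbU).measurable_piecewise
      (g := fun _ => (0 : ℂ)) continuousOn_const measurableSet_ball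
    have e : a i = (ball p R).piecewise (A i) fun _ => 0 := piecewise_eq_indicator.symm
    rwa [e]
  have hab : ∀ i, ∃ C : NNReal, ∀ z, ‖a i z‖ ≤ C := fun i => by
    obtain ⟨C, hC⟩ := (isCompact_closedBall p R).exists_bound_of_continuousOn
      ((hΦ.analytic i).continuousOn.mono hcb)
    refine ⟨⟨max C 0, le_max_right _ _⟩, fun z => ?_⟩
    by_cases hz : z ∈ ball p R
    · rw [haA i hz]
      exact (hC z (ball_subset_closedBall hz)).trans (le_max_left _ _)
    · rw [show a i z = 0 from indicator_of_notMem hz _, norm_zero]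
      exact NNReal.coe_nonneg _
  choose C hC using hab
  have hFm : Measurable F :=
    Finset.measurable_sum _ fun i _ => (ham i).indicator (hΦ.isOpen i).measurableSet
  have hFb : ∀ z, ‖F z‖ ≤ ((∑ i, C i : NNReal) : ℝ) := fun z => by
    push_cast
    exact (norm_sum_le _ _).trans
      (Finset.sum_le_sum fun i _ => (norm_indicator_le_norm_self _ _).trans (hC i z))
  have hli : ∀ {f : ℂ → ℂ} {c : NNReal}, Measurable f → (∀ z, ‖f z‖ ≤ c) →
      LocallyIntegrable f volume := fun hf hc => by
    refine (locallyIntegrable_const (_ : ℝ)).mono hf.aestronglyMeasurable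
      (ae_of_all _ fun z => (hc z).trans (le_abs_self _))
  have hFl := hli hFm hFb
  have hal : ∀ i, LocallyIntegrable (a i) volume := fun i => hli (ham i) (hC i)
  have hFM : ∀ i, ∀ z, z ∈ M i → F z = a i z := fun i z hz => hΦ.sum_indicator_eq a hz
  have hΦF : ∀ᵐ z ∂(volume.restrict (ball p R)), Φ z = F z := by
    filter_upwards [haeb, ae_restrict_mem measurableSet_ball] with z ⟨⟨i, hi⟩, hz⟩ hzb
    rw [hz, hΦ.sum_indicator_eq A hi, hFM i z hi, haA i hzb]
  have hdb : DbarNonneg (ball p R) F :=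
    dbarNonneg_of_mem_sigmaClass hΦ.locallyIntegrableOn hpos hbU measurableSet_ball hΦF
  -- the potential `u` of `Φ`, and functions `h i` continuous on the plane that agree with the
  -- potentials of the `A i` on the smaller disc
  set R₂ := R / 2 with hR₂
  have hR₂0 : 0 < R₂ := by positivity
  have hR₂R : R₂ < R := by linarith
  have hb₂ : ball p R₂ ⊆ ball p R := ball_subset_ball hR₂R.le
  obtain ⟨u, hu, hup, hW⟩ := exists_weakPotential hFm hFb hR₂R hdb
  have hAan : ∀ i, AnalyticOnNhd ℂ (A i) (ball p R) := fun i => (hΦ.analytic i).mono hbU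
  have hpot : ∀ i, ∀ z ∈ ball p R, HasFDerivAt (potential U (A i) p) (reMul (A i z)) z :=
    fun i z hz => hasFDerivAt_potential hbU (hAan i) hz
  choose h hh hheq using fun i => exists_continuous_eqOn_ball hR₂0 hR₂R
    (f := potential U (A i) p) fun z hz => (hpot i z hz).continuousAt.continuousWithinAt
  have hhd : ∀ i, ∀ z ∈ ball p R₂, HasFDerivAt (h i) (reMul (a i z)) z := fun i z hz => by
    rw [haA i (hb₂ hz)]
    refine (hpot i z (hb₂ hz)).congr_of_eventuallyEq ?_
    filter_upwards [isOpen_ball.mem_nhds hz] with w hw using hheq i hw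
  have hac : ∀ i, ContinuousOn (a i) (ball p R₂) := fun i =>
    ((hAan i).continuousOn.mono hb₂).congr fun z hz => haA i (hb₂ hz)
  have hpb : p ∈ ball p R₂ := mem_ball_self hR₂0
  have hap : ∀ i, a i p = A i p := fun i => haA i (hb₂ hpb)
  have hinj : Function.Injective fun i => A i p := fun i k hik => by
    by_contra hne'
    exact hne i k hne' hik
  -- some piece is active at `p`
  have hnonempty : Nonempty (activeSet M p) := by
    by_contra hempty
    have hfalse : ∀ᵐ z ∂(volume.restrict (ball p R)), False := by
      filter_upwards [haeb, ae_restrict_mem measurableSet_ball] with z ⟨⟨i, hi⟩, _⟩ hzb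
      exact hempty ⟨⟨i, hact z hzb i hi⟩⟩
    rw [ae_iff] at hfalse
    simp [hR0.not_ge, NNReal.pi_pos.ne'] at hfalse
  have hhull : hull M A p = convexHull ℝ (range fun i : activeSet M p => a i p) := by
    rw [hull, image_eq_range]
    simp only [hap]
  have hmain := eventually_eq_iSup (ι := activeSet M p) hR₂0 (A := fun i => a i)
    (h := fun i => h i) (M := fun i => M i) (F := F) (u := u)
    (fun i => hac i) (fun i k hik => Subtype.ext (hinj (by simpa only [hap] using hik)))
    (fun i => hh i) (fun i => (hheq i hpb).trans (potential_self _ _ hp))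
    (fun i => hhd i p hpb) (fun i => hΦ.isOpen i) (fun i => i.2) hu hup ?_
    (fun i => hFl.sub (hal i))
    (fun i => hW.sub_of_hasFDerivAt isOpen_ball hu hFl (hac i) (hhd i))
    (fun i => (hdb.mono hb₂).sub_analytic isOpen_ball hFl ((hAan i).mono hb₂)
      fun z hz => haA i (hb₂ hz)) ?_
  · obtain ⟨R₁, hR₁, hb₁⟩ := Metric.eventually_nhds_iff_ball.1 hmain
    set s := min R₁ R₂ with hs
    have hs₁ : ball p s ⊆ ball p R₁ := ball_subset_ball (min_le_left _ _)
    have hs₂ : ball p s ⊆ ball p R₂ := ball_subset_ball (min_le_right _ _)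
    have hsU : ball p s ⊆ (U : Set ℂ) := hs₂.trans (hb₂.trans hbU)
    refine ⟨⟨ball p s, isOpen_ball⟩, mem_ball_self (lt_min hR₁ hR₂0), hsU, ?_⟩
    refine eqTwoDz_of_weakPotential (F := F) (u := u) (hΦ.locallyIntegrableOn.mono_set hsU)
      (ae_restrict_of_ae_restrict_of_subset (hs₂.trans hb₂) hΦF) hu (hW.mono hs₂) fun z hz => ?_
    rw [hb₁ z (hs₁ hz), maxPotential]
    exact iSup_congr fun i => (hheq i (hs₂ hz)).symm
  · filter_upwards [ae_restrict_of_ae_restrict_of_subset hb₂ haeb,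
      ae_restrict_mem measurableSet_ball] with z ⟨⟨i, hi⟩, _⟩ hz
    exact ⟨⟨⟨i, hact z (hb₂ hz) i hi⟩, hi⟩, fun j hj => hFM j z hj⟩
  · intro i
    rw [← hhull, hap]
    by_cases hi : (i : Fin r) ∈ extremeSet M A p
    · exact Or.inl hi.2
    · have hfr := hK i ⟨i.2, hi⟩
      have hmem : A i p ∈ hull M A p := subset_convexHull ℝ _ (mem_image_of_mem _ i.2)
      refine Or.inr ?_
      by_contra hint
      exact hfr ⟨subset_closure hmem, hint⟩
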